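/- Let $K$ be a totally real number field of degree $n$ with ring of integers $\mathcal{O}$, regulator $R$ and discriminant $D$, of narrow class number one (every non-zero ideal of $\mathcal{O}$ has a totally positive generator). Let $\psi_1,\dots,\psi_n$ be the embeddings $K\to\mathbf{R}$ in some order, write $a^{(j)}=\psi_j(a)$, and let $\epsilon_1,\dots,\epsilon_{n-1}$ be units which together with $-1$ generate $\mathcal{O}^\times$. Let $(e_{j,q})_{1\le j,q\le n}$ be the inverse of the $n\times n$ matrix whose $q$-th row is $(\log|\epsilon_q^{(1)}|,\dots,\log|\epsilon_q^{(n)}|)$ for $q\le n-1$ and whose last row is $(1,\dots,1)$, and for $m\in\mathbf{Z}^{n-1}$ put $\rho_j(m)=\pi\sum_{q=1}^{n-1}m_qe_{j,q}$. Let $\mathbf{H}$ be the upper half plane. Let $\Gamma=\mathrm{PSL}(2,\mathcal{O})$ act on $\mathbf{H}^n$ by Möbius transformations $(\gamma z)_j=\gamma^{(j)}z_j$, let $\Gamma_\infty$ be the subgroup of classes of upper triangular matrices, and let $d\mu=\prod_{j=1}^n dx_j\,dy_j/y_j^2$, where $z_j=x_j+iy_j$. Let $h:(0,\infty)\to\mathbf{C}$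 be smooth and bounded with $h(y)y^p\to0$ as $y\to\infty$ and $h(y)y^{-p}\to0$ as $y\to0$ for all $p\in\mathbf{N}$, let $m\in\mathbf{Z}^{n-1}$, and put $$F(z,h,m)=\sum_{\gamma\in\Gamma_\infty\backslash\Gamma}h\Big(\prod_{j=1}^n\operatorname{Im}(\gamma^{(j)}z_j)\Big)\prod_{j=1}^n\operatorname{Im}(\gamma^{(j)}z_j)^{i\rho_j(m)}.$$ Then the terms of this series depend only on the coset of $\gamma$, the series converges absolutely for every $z\in\mathbf{H}^n$, and $F(\cdot,h,m)$ is $\Gamma$-invariant. The action of $\Gamma$ on $(\mathbf{H}^n,\mu)$ has a (measurable) fundamental domain, and $F(\cdot,h,m)$ is integrable over $\Gamma\backslash\mathbf{H}^n$, that is, over every such fundamental domain, with an integral that does not depend on the choice of the domain. If $m\neq0$, then $$\int_{\Gamma\backslash\mathbf{H}^n}F(z,h,m)\,d\mu(z)=0,$$ and for $m=0$ the function $h(w)w^{-2}$ is integrable on $(0,\infty)$ and $$\int_{\Gamma\backslash\mathbf{H}^n}F(z,h,0)\,d\mu(z)=2^{n-1}R\sqrt{D}\int_0^\infty\frac{h(w)}{w^2}\,dw.$$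 -/

import Mathlib

open MeasureTheory Filter Topology UpperHalfPlane
open scoped MatrixGroups NumberField ContDiff

noncomputable section

namespace HilbertModular

variable (K : Type*) [Field K] [NumberField K]

/-- Every non-zero ideal of the ring of integers has a generator which is positive under all
real embeddings. (In particular the ring of integers is a principal ideal domain.) -/
def NarrowClassNumberOne : Prop :=
  ∀ I : Ideal (𝓞 K), I ≠ ⊥ →
    ∃ a : 𝓞 K, (∀ φ : K →+* ℝ, 0 < φ (a : K)) ∧ I = Ideal.span {a}

/-- The product of upper half planes, one for each embedding of `K` into `ℝ`. Its `volume` is the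
product of the measures `dx dy / y ^ 2`. -/
abbrev HalfSpace : Type _ := (K →+* ℝ) → ℍ

/-- The Hilbert modular group `PSL(2, 𝓞 K)`. -/
abbrev ModularGroup : Type _ := PSL(2, 𝓞 K)

variable {K}

/-- The matrix over `ℝ` obtained by applying the embedding `φ` to all entries. -/
def conj (φ : K →+* ℝ) : SL(2, 𝓞 K) →* SL(2, ℝ) :=
  Matrix.SpecialLinearGroup.map (φ.comp (algebraMap (𝓞 K) K))

variable (K)

/-- The action of `SL(2, 𝓞 K)` on the product of upper half planes: in the coordinate belonging to
`φ` a matrix acts by the Möbius transformation with coefficients conjugated by `φ`. -/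
def slAction : SL(2, 𝓞 K) →* Equiv.Perm (HalfSpace K) where
  toFun A :=
    { toFun := fun z φ => conj φ A • z φ
      invFun := fun z φ => (conj φ A)⁻¹ • z φ
      left_inv := fun z => by funext φ; simp
      right_inv := fun z => by funext φ; simp }
  map_one' := by ext z φ; simp
  map_mul' A B := by ext z φ; simp [mul_smul]

variable {K}

/-- Scalar matrices act trivially. -/
theorem slAction_center (A : SL(2, 𝓞 K)) (hA : A ∈ Subgroup.center SL(2, 𝓞 K)) :
    slAction K A = 1 := by
  obtain ⟨r, hr, h⟩ := Matrix.SpecialLinearGroup.mem_center_iff.1 hA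
  have h00 : A 0 0 = r := by rw [← h]; simp
  have h01 : A 0 1 = 0 := by rw [← h]; simp
  have h10 : A 1 0 = 0 := by rw [← h]; simp
  have h11 : A 1 1 = r := by rw [← h]; simp
  have hr0 : (r : K) ≠ 0 := by
    intro h0
    have : r = 0 := by exact_mod_cast h0
    subst this
    simp at hr
  ext z φ
  have hne : ((φ (r : K) : ℝ) : ℂ) ≠ 0 := by
    simpa using hr0
  change ((conj φ A • z φ : ℍ) : ℂ) = (z φ : ℂ)
  rw [UpperHalfPlane.coe_specialLinearGroup_apply]
  simp only [conj, Matrix.SpecialLinearGroup.map_apply_coe, RingHom.mapMatrix_apply,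
    Matrix.map_apply, h00, h01, h10, h11, map_zero, RingHom.comp_apply]
  simp only [Algebra.algebraMap_self, RingHom.id_apply, Complex.ofReal_zero, add_zero, zero_mul,
    zero_add]
  exact mul_div_cancel_left₀ _ hne

/-- The induced action of `PSL(2, 𝓞 K)`. -/
instance : MulAction (ModularGroup K) (HalfSpace K) :=
  MulAction.compHom (HalfSpace K)
    (QuotientGroup.lift (Subgroup.center SL(2, 𝓞 K)) (slAction K) slAction_center)

theorem mk_smul_apply (A : SL(2, 𝓞 K)) (z : HalfSpace K) (φ : K →+* ℝ) :
    ((((QuotientGroup.mk A : ModularGroup K) • z) φ : ℍ) : ℂ) =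
      (φ (A 0 0 : K) * (z φ : ℂ) + φ (A 0 1 : K)) / (φ (A 1 0 : K) * (z φ : ℂ) + φ (A 1 1 : K)) := by
  change ((conj φ A • z φ : ℍ) : ℂ) = _
  rw [UpperHalfPlane.coe_specialLinearGroup_apply]
  rfl

variable (K)

/-- The upper triangular matrices in `SL(2, 𝓞 K)`. -/
def upperTriangular : Subgroup SL(2, 𝓞 K) where
  carrier := {A | A 1 0 = 0}
  one_mem' := by simp
  mul_mem' {A B} hA hB := by
    simp only [Set.mem_ofPred_eq] at hA hB ⊢
    simp [Matrix.mul_apply, Fin.sum_univ_two, hA, hB]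
  inv_mem' {A} hA := by
    simp only [Set.mem_ofPred_eq] at hA ⊢
    simp [Matrix.SpecialLinearGroup.coe_inv, Matrix.adjugate_fin_two, hA]

/-- The stabilizer of `∞` in `PSL(2, 𝓞 K)`: the classes of the upper triangular matrices. -/
def stabInfty : Subgroup (ModularGroup K) :=
  (upperTriangular K).map (QuotientGroup.mk' (Subgroup.center SL(2, 𝓞 K)))

variable {K} {n : ℕ}

/-- The `n × n` matrix whose first `n - 1` rows are `(log |ε_q^{(1)}|, …, log |ε_q^{(n)}|)`, where
`a^{(j)} = ψ j a`, and whose last row is `(1, …, 1)`. -/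
def unitMatrix (ψ : Fin n ≃ (K →+* ℝ)) (ε : Fin (n - 1) → (𝓞 K)ˣ) : Matrix (Fin n) (Fin n) ℝ :=
  Matrix.of fun i j => if h : (i : ℕ) < n - 1 then Real.log |ψ j ((ε ⟨i, h⟩ : 𝓞 K) : K)| else 1

/-- `ρ_j(m) = π ∑_q m_q e_{j,q}`, where `(e_{j,q})` is the inverse of the unit matrix. -/
def rho (ψ : Fin n ≃ (K →+* ℝ)) (ε : Fin (n - 1) → (𝓞 K)ˣ) (m : Fin (n - 1) → ℤ) (j : Fin n) : ℝ :=
  Real.pi * ∑ q : Fin (n - 1), (m q : ℝ) * (unitMatrix ψ ε)⁻¹ j (Fin.castLE (Nat.sub_le n 1) q)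

/-- The term `h(∏_j Im(γ^{(j)} z_j)) ∏_j Im(γ^{(j)} z_j)^{i ρ_j(m)}` belonging to `γ`. -/
def eisensteinTerm (ψ : Fin n ≃ (K →+* ℝ)) (ε : Fin (n - 1) → (𝓞 K)ˣ) (h : ℝ → ℂ)
    (m : Fin (n - 1) → ℤ) (z : HalfSpace K) (γ : ModularGroup K) : ℂ :=
  h (∏ j, ((γ • z) (ψ j)).im) *
    ∏ j, ((((γ • z) (ψ j)).im : ℝ) : ℂ) ^ (Complex.I * (rho ψ ε m j : ℂ))

/-- The set `Γ_∞ \ Γ` of right cosets of the stabilizer of `∞`. -/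
abbrev Cosets (K : Type*) [Field K] [NumberField K] : Type _ :=
  Quotient (QuotientGroup.rightRel (stabInfty K))

/-- The incomplete Eisenstein series `F(z, h, m)`: the sum over `Γ_∞ \ Γ` of the terms of
representatives of the cosets. -/
def incompleteEisenstein (ψ : Fin n ≃ (K →+* ℝ)) (ε : Fin (n - 1) → (𝓞 K)ˣ) (h : ℝ → ℂ)
    (m : Fin (n - 1) → ℤ) (z : HalfSpace K) : ℂ :=
  ∑' c : Cosets K, eisensteinTerm ψ ε h m z c.out

/-- The functions `h` on `(0, ∞)` which induce incomplete Eisenstein series: smooth, bounded, and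
such that `h(y) y^p → 0` as `y → ∞` and `h(y) y^{-p} → 0` as `y → 0` for all natural `p`.
Values of `h` outside `(0, ∞)` play no role. -/
structure IsInducing (h : ℝ → ℂ) : Prop where
  smooth : ContDiffOn ℝ ∞ h (Set.Ioi 0)
  bounded : ∃ C : ℝ, ∀ y : ℝ, 0 < y → ‖h y‖ ≤ C
  decay_atTop : ∀ p : ℕ, Tendsto (fun y : ℝ => h y * (y : ℂ) ^ p) atTop (𝓝 0)
  decay_zero : ∀ p : ℕ, Tendsto (fun y : ℝ => h y / (y : ℂ) ^ p) (𝓝[>] 0) (𝓝 0)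

end HilbertModular

end

noncomputable section

set_option linter.unusedSectionVars false

namespace HilbertModular

variable {K : Type*} [Field K] [NumberField K] {n : ℕ}

/-! The proof unfolds the sum. With `f(z) = h(∏ y_j) ∏ y_j ^ (iρ_j)`, invariant under `Γ_∞`, the
integral of `F = ∑ f(γz)` over `Γ\ℍⁿ` equals that of `f` over `Γ_∞\ℍⁿ` (`integral_tsum_out`).

A class in `Γ_∞` is a translation by an integer combined with `y_j ↦ (u^{(j)})² y_j` for a unit `u`.
Expand the vector `(log y_j)` in the rows of the unit matrix. The unit `±∏ ε_q ^ k_q` adds `2k_q` to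
the first `n - 1` coordinates and leaves the last one alone. So a fundamental domain of `Γ_∞` is
given by `x` in a cell of the lattice `𝓞`, of volume `√D`, the first `n - 1` coordinates in `[0,
2)`, and the last one free (`isFundamentalDomain_stabDomain`).

In these coordinates the integrand with its density `∏ y_j⁻¹` is a product (`stripFn_vecMul`):
`exp(iπ m_q t)` on `[0, 2)` for each `q`, and `h(e^{nt}) e^{-nt}` for the last coordinate. The
former integrate to `2` or `0` according to whether `m_q = 0`, the latter to `n⁻¹ ∫ h(w) w⁻² dw`.
The Jacobian is `nR` (`abs_det_unitMatrix`), so `n` cancels.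

Absolute convergence (`summable_norm_eisensteinTerm`) comes from choosing the lower row `(c, d)` of
a coset, up to units, so that all `|c^{(j)} z_j + d^{(j)}|` are comparable; the series is then
dominated by a convergent sum over a lattice of rank `2n`. A fundamental domain of `Γ` exists
because the action is properly discontinuous and free almost everywhere. -/

/-! ### Units, the regulator and the exponents `ρ(m)` -/

theorem exists_unit_eq_prod_zpow {ε : Fin (n - 1) → (𝓞 K)ˣ}
    (hε : Subgroup.closure (insert (-1) (Set.range ε)) = ⊤) (u : (𝓞 K)ˣ) :
    ∃ k : Fin (n - 1) → ℤ, u = ∏ q, ε q ^ k q ∨ u = -∏ q, ε q ^ k q := by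
  have hu : u ∈ Subgroup.closure (insert (-1) (Set.range ε)) := hε ▸ Subgroup.mem_top u
  rw [Set.insert_eq, Subgroup.closure_union, Subgroup.mem_sup] at hu
  obtain ⟨s, hs, t, ht, rfl⟩ := hu
  obtain ⟨k, rfl⟩ := Subgroup.exists_of_mem_closure_range ε t ht
  obtain ⟨a, rfl⟩ := Subgroup.mem_closure_singleton.1 hs
  refine ⟨k, ?_⟩
  rcases Int.even_or_odd a with h | h
  · left; rw [h.neg_one_zpow, one_mul]
  · right; rw [h.neg_one_zpow, neg_one_mul]

theorem finrank_pos_of_eq (hn : Module.finrank ℚ K = n) : 0 < n :=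
  hn ▸ Module.finrank_pos

/-- The rows of the unit matrix which belong to the units. -/
theorem unitMatrix_lt (ψ : Fin n ≃ (K →+* ℝ)) (ε : Fin (n - 1) → (𝓞 K)ˣ) (q : Fin (n - 1))
    (j : Fin n) : unitMatrix ψ ε (Fin.castLE (Nat.sub_le n 1) q) j =
      Real.log |ψ j ((ε q : 𝓞 K) : K)| := by
  simp [unitMatrix]

theorem unitMatrix_last (ψ : Fin n ≃ (K →+* ℝ)) (ε : Fin (n - 1) → (𝓞 K)ˣ) {i : Fin n}
    (hi : ¬ (i : ℕ) < n - 1) (j : Fin n) : unitMatrix ψ ε i j = 1 := by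
  simp [unitMatrix, hi]

/-- The infinite place of a real embedding. -/
def placeOf (φ : K →+* ℝ) : NumberField.InfinitePlace K :=
  NumberField.InfinitePlace.mk (Complex.ofRealHom.comp φ)

theorem placeOf_apply (φ : K →+* ℝ) (x : K) : placeOf φ x = |φ x| := by
  simp [placeOf, NumberField.InfinitePlace.apply]

theorem placeOf_bijective [NumberField.IsTotallyReal K] :
    Function.Bijective (placeOf : (K →+* ℝ) → NumberField.InfinitePlace K) := by
  constructor
  · intro φ φ' h
    have : Complex.ofRealHom.comp φ = Complex.ofRealHom.comp φ' := by
      rcases NumberField.InfinitePlace.mk_eq_iff.1 h with h | h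
      · exact h
      · rw [← h]
        ext x
        simp [NumberField.ComplexEmbedding.conjugate]
    ext x
    have := RingHom.congr_fun this x
    simpa using this
  · intro w
    have hw := NumberField.IsTotallyReal.isReal w
    refine ⟨NumberField.InfinitePlace.embedding_of_isReal hw, ?_⟩
    refine NumberField.InfinitePlace.ext _ _ fun x => ?_
    rw [placeOf_apply, ← Real.norm_eq_abs, NumberField.InfinitePlace.norm_embedding_of_isReal]

theorem placeOf_mult [NumberField.IsTotallyReal K] (w : NumberField.InfinitePlace K) :
    w.mult = 1 :=
  NumberField.InfinitePlace.mult_isReal ⟨w, NumberField.IsTotallyReal.isReal w⟩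

open NumberField.Units in
-- The quotient of the two regulators is the index of the subgroup generated by the family and the
-- torsion, which is `1` because `-1` is torsion.
theorem regOfFamily_eq_regulator {e : Fin (rank K) → (𝓞 K)ˣ}
    (he : Subgroup.closure (insert (-1) (Set.range e)) = ⊤) :
    regOfFamily e = regulator K := by
  have h := regOfFamily_div_regulator e
  have htop : Subgroup.closure (Set.range e) ⊔ torsion K = ⊤ := by
    rw [eq_top_iff, ← he, Subgroup.closure_le]
    rintro x (rfl | hx)
    · refine Subgroup.mem_sup_right ?_
      exact (CommGroup.mem_torsion (-1 : (𝓞 K)ˣ)).2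
        (isOfFinOrder_iff_pow_eq_one.2 ⟨2, by norm_num, by simp⟩)
    · exact Subgroup.mem_sup_left (Subgroup.subset_closure hx)
  rw [htop, Subgroup.index_top, Nat.cast_one, div_eq_one_iff_eq (regulator_ne_zero K)] at h
  exact h

/-- `finrank_mul_regOfFamily_eq_det` is this identity for a matrix indexed by infinite places,
bordered by a row of multiplicities. All places are real, so the multiplicities are `1` and only a
reindexing remains. -/
theorem abs_det_unitMatrix [NumberField.IsTotallyReal K] (hn : Module.finrank ℚ K = n)
    (ψ : Fin n ≃ (K →+* ℝ)) {ε : Fin (n - 1) → (𝓞 K)ˣ}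
    (hε : Subgroup.closure (insert (-1) (Set.range ε)) = ⊤) :
    |(unitMatrix ψ ε).det| = n * NumberField.Units.regulator K := by
  classical
  have hpos := finrank_pos_of_eq hn
  let E : Fin n ≃ NumberField.InfinitePlace K := ψ.trans (Equiv.ofBijective _ placeOf_bijective)
  have hcard : Fintype.card (NumberField.InfinitePlace K) = n := by
    rw [← Fintype.card_congr E, Fintype.card_fin]
  have hrank : NumberField.Units.rank K = n - 1 := by rw [NumberField.Units.rank, hcard]
  let c : Fin (NumberField.Units.rank K) ≃ Fin (n - 1) := finCongr hrank
  -- The index of the row of ones; its place `E l` is the one omitted from the regulator.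
  let l : Fin n := ⟨n - 1, by omega⟩
  have hlt : ∀ w : {w // w ≠ E l}, ((E.symm w : Fin n) : ℕ) < n - 1 := fun w => by
    have h1 : E.symm w ≠ l := fun h => w.2 ((Equiv.symm_apply_eq E).1 h)
    have h2 : ((E.symm w : Fin n) : ℕ) ≠ n - 1 := fun h => h1 (Fin.ext h)
    have := (E.symm w : Fin n).2
    omega
  let e : {w // w ≠ E l} ≃ Fin (NumberField.Units.rank K) :=
    Equiv.ofBijective (fun w => c.symm ⟨E.symm w, hlt w⟩) <| by
      rw [Fintype.bijective_iff_injective_and_card]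
      constructor
      · intro w w' h
        have := c.symm.injective h
        simp only [Fin.mk.injEq] at this
        exact Subtype.ext (E.symm.injective (Fin.ext this))
      · rw [Fintype.card_subtype_compl, Fintype.card_fin, hcard, hrank,
          Fintype.card_subtype_eq]
  have hcl : Subgroup.closure (insert (-1) (Set.range (ε ∘ c))) = ⊤ := by
    rw [c.surjective.range_comp, hε]
  have key := NumberField.Units.finrank_mul_regOfFamily_eq_det (ε ∘ c) (E l) e
  rw [regOfFamily_eq_regulator hcl, hn] at key
  rw [key, ← Matrix.det_reindex_self E]
  congr 2
  ext w w'
  have hw' : ∀ x : K, w' x = |ψ (E.symm w') x| := fun x => by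
    rw [← placeOf_apply]
    congr 1
    exact (E.apply_symm_apply w').symm
  rw [Matrix.reindex_apply, Matrix.submatrix_apply, Matrix.of_apply]
  by_cases h : w = E l
  · subst h
    rw [dif_pos rfl, placeOf_mult, unitMatrix_last]
    · simp
    · simp [l]
  · rw [dif_neg h, placeOf_mult, Nat.cast_one, one_mul, hw', unitMatrix, Matrix.of_apply,
      dif_pos (hlt ⟨w, h⟩)]
    simp [e]

theorem det_unitMatrix_ne_zero [NumberField.IsTotallyReal K] (hn : Module.finrank ℚ K = n)
    (ψ : Fin n ≃ (K →+* ℝ)) {ε : Fin (n - 1) → (𝓞 K)ˣ}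
    (hε : Subgroup.closure (insert (-1) (Set.range ε)) = ⊤) : (unitMatrix ψ ε).det ≠ 0 := by
  rw [← abs_pos, abs_det_unitMatrix hn ψ hε]
  have := finrank_pos_of_eq hn
  have := NumberField.Units.regulator_pos K
  positivity

/-- The coordinates of `ρ(m)` in the dual basis: `π m_q` at `q`, and `0` at the last place. -/
def dualCoord (m : Fin (n - 1) → ℤ) (i : Fin n) : ℝ :=
  if h : (i : ℕ) < n - 1 then Real.pi * m ⟨i, h⟩ else 0

theorem sum_castLE {M : Type*} [AddCommMonoid M] (f : Fin n → M)
    (hf : ∀ i : Fin n, ¬ (i : ℕ) < n - 1 → f i = 0) :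
    ∑ i, f i = ∑ q : Fin (n - 1), f (Fin.castLE (Nat.sub_le n 1) q) := by
  symm
  refine Finset.sum_of_injOn (Fin.castLE (Nat.sub_le n 1)) (Fin.castLE_injective _).injOn
    (by simp) ?_ (by simp)
  intro i _ hi
  refine hf i fun h => hi ?_
  exact ⟨⟨i, h⟩, by simp, by ext; simp⟩

theorem rho_eq_mulVec (ψ : Fin n ≃ (K →+* ℝ)) (ε : Fin (n - 1) → (𝓞 K)ˣ)
    (m : Fin (n - 1) → ℤ) : rho ψ ε m = Matrix.mulVec (unitMatrix ψ ε)⁻¹ (dualCoord m) := by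
  ext j
  rw [rho, Matrix.mulVec, dotProduct,
    sum_castLE (fun i => (unitMatrix ψ ε)⁻¹ j i * dualCoord m i)
      (fun i hi => by simp [dualCoord, hi]), Finset.mul_sum]
  refine Finset.sum_congr rfl fun q _ => ?_
  simp [dualCoord]
  ring

/-- The characterisation of the exponents: `ρ(m)` pairs to `π m_q` with the logarithms of `ε_q`, and
its entries sum to `0`. -/
theorem unitMatrix_mulVec_rho [NumberField.IsTotallyReal K] (hn : Module.finrank ℚ K = n)
    (ψ : Fin n ≃ (K →+* ℝ)) {ε : Fin (n - 1) → (𝓞 K)ˣ}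
    (hε : Subgroup.closure (insert (-1) (Set.range ε)) = ⊤) (m : Fin (n - 1) → ℤ) :
    Matrix.mulVec (unitMatrix ψ ε) (rho ψ ε m) = dualCoord m := by
  rw [rho_eq_mulVec, Matrix.mulVec_mulVec, Matrix.mul_nonsing_inv _
    (isUnit_iff_ne_zero.2 (det_unitMatrix_ne_zero hn ψ hε)), Matrix.one_mulVec]

/-- The coordinates of the vector of logarithms `log |u^{(j)}|` of the unit `u = ±∏ ε_q ^ k_q` with
respect to the rows of the unit matrix. -/
def unitCoord (k : Fin (n - 1) → ℤ) (i : Fin n) : ℝ :=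
  if h : (i : ℕ) < n - 1 then k ⟨i, h⟩ else 0

theorem log_abs_prod_zpow (ψ : Fin n ≃ (K →+* ℝ)) (ε : Fin (n - 1) → (𝓞 K)ˣ)
    (k : Fin (n - 1) → ℤ) {u : (𝓞 K)ˣ} (hu : u = ∏ q, ε q ^ k q ∨ u = -∏ q, ε q ^ k q)
    (j : Fin n) :
    Real.log |ψ j ((u : 𝓞 K) : K)| = Matrix.vecMul (unitCoord k) (unitMatrix ψ ε) j := by
  have h1 : |ψ j ((u : 𝓞 K) : K)| = ∏ q, |ψ j ((ε q : 𝓞 K) : K)| ^ k q := by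
    let f : (𝓞 K)ˣ →* ℝ := (absHom.toMonoidHom.comp
      ((ψ j).comp (algebraMap (𝓞 K) K)).toMonoidHom).comp (Units.coeHom (𝓞 K))
    have hf : ∀ v : (𝓞 K)ˣ, f v = |ψ j ((v : 𝓞 K) : K)| := fun v => rfl
    have hz : ∀ (v : (𝓞 K)ˣ) (a : ℤ), f (v ^ a) = f v ^ a := fun v a => by
      simp
    have hneg : ∀ v : (𝓞 K)ˣ, f (-v) = f v := fun v => by simp [hf]
    rw [← hf]
    rcases hu with rfl | rfl
    · rw [map_prod]; simp [hz, hf]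
    · rw [hneg, map_prod]; simp [hz, hf]
  rw [h1, Real.log_prod (fun q _ => by
      refine zpow_ne_zero _ (abs_ne_zero.2 ?_)
      simp), Matrix.vecMul, dotProduct,
    sum_castLE (fun i => unitCoord k i * unitMatrix ψ ε i j)
      (fun i hi => by simp [unitCoord, hi])]
  refine Finset.sum_congr rfl fun q _ => ?_
  rw [unitMatrix_lt, Real.log_zpow]
  simp [unitCoord]

theorem sum_vecMul_unitMatrix [NumberField.IsTotallyReal K] (hn : Module.finrank ℚ K = n)
    (ψ : Fin n ≃ (K →+* ℝ)) {ε : Fin (n - 1) → (𝓞 K)ˣ}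
    (hε : Subgroup.closure (insert (-1) (Set.range ε)) = ⊤) (m : Fin (n - 1) → ℤ)
    (c : Fin n → ℝ) :
    ∑ j, rho ψ ε m j * Matrix.vecMul c (unitMatrix ψ ε) j = ∑ i, c i * dualCoord m i := by
  have : Matrix.vecMul c (unitMatrix ψ ε) ⬝ᵥ rho ψ ε m = c ⬝ᵥ dualCoord m := by
    rw [← Matrix.dotProduct_mulVec, unitMatrix_mulVec_rho hn ψ hε]
  simpa [dotProduct, mul_comm] using this

/-- A unit has norm `±1`. -/
theorem prod_abs_unit [NumberField.IsTotallyReal K] (u : (𝓞 K)ˣ) :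
    ∏ φ : K →+* ℝ, |φ ((u : 𝓞 K) : K)| = 1 := by
  have h := NumberField.InfinitePlace.prod_eq_abs_norm ((u : 𝓞 K) : K)
  rw [NumberField.Units.norm, Rat.cast_one] at h
  rw [← h, ← (Equiv.ofBijective _ (placeOf_bijective (K := K))).prod_comp]
  refine Finset.prod_congr rfl fun φ _ => ?_
  rw [placeOf_mult, pow_one]
  exact (placeOf_apply φ _).symm

theorem card_embeddings (ψ : Fin n ≃ (K →+* ℝ)) : Fintype.card (K →+* ℝ) = n := by
  rw [← Fintype.card_congr ψ, Fintype.card_fin]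

/-! ### Integral bases, upper triangular matrices and automorphy factors -/

/-- Indexing the basis by the real embeddings makes the matrix square. As there are `n` of them,
they exhaust the complex embeddings, so the discriminant is the square of this real determinant. -/
theorem exists_integral_basis [DecidableEq (K →+* ℝ)] (hn : Module.finrank ℚ K = n)
    (ψ : Fin n ≃ (K →+* ℝ)) :
    ∃ b : Module.Basis (K →+* ℝ) ℤ (𝓞 K),
      |(Matrix.of fun i φ : K →+* ℝ => φ (b i : K)).det| =
        Real.sqrt |(NumberField.discr K : ℝ)| := by
  have hcard : Fintype.card (Module.Free.ChooseBasisIndex ℤ (𝓞 K)) = Fintype.card (K →+* ℝ) := by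
    rw [← Module.finrank_eq_card_chooseBasisIndex, NumberField.RingOfIntegers.rank, hn,
      card_embeddings ψ]
  let b := (NumberField.RingOfIntegers.basis K).reindex (Fintype.equivOfCardEq hcard)
  refine ⟨b, ?_⟩
  let e : (K →+* ℝ) ≃ (K →ₐ[ℚ] ℂ) :=
    Equiv.ofBijective (fun φ => (Complex.ofRealHom.comp φ).toRatAlgHom) <| by
      rw [Fintype.bijective_iff_injective_and_card, AlgHom.card, hn, card_embeddings ψ]
      refine ⟨fun φ φ' h => ?_, rfl⟩
      ext x
      have := AlgHom.congr_fun h x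
      simpa using this
  have h := Algebra.discr_eq_det_embeddingsMatrixReindex_pow_two ℚ ℂ
    (fun i => (b i : K)) e
  have hM : Algebra.embeddingsMatrixReindex ℚ ℂ (fun i => (b i : K)) e =
      (Matrix.of fun i φ : K →+* ℝ => φ (b i : K)).map Complex.ofRealHom := by
    ext i φ
    rfl
  have hd : Algebra.discr ℚ (fun i => (b i : K)) = (NumberField.discr K : ℚ) := by
    rw [← NumberField.discr_eq_discr K b]
    have := Algebra.discr_localizationLocalization ℤ (nonZeroDivisors ℤ) K b (Rₘ := ℚ)
    rw [eq_intCast] at this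
    rw [← this]
    congr 1
    ext i
    simp
  rw [hM, ← RingHom.mapMatrix_apply, ← RingHom.map_det, hd] at h
  have h' : (NumberField.discr K : ℝ) =
      (Matrix.of fun i φ : K →+* ℝ => φ (b i : K)).det ^ 2 := by
    have : ((NumberField.discr K : ℝ) : ℂ) =
        (((Matrix.of fun i φ : K →+* ℝ => φ (b i : K)).det ^ 2 : ℝ) : ℂ) := by
      simpa using h
    exact_mod_cast this
  rw [h', abs_pow, Real.sqrt_sq (abs_nonneg _)]

/-- The upper triangular matrix with diagonal `(u, u⁻¹)` and upper right entry `b`. -/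
def upperMat (u : (𝓞 K)ˣ) (b : 𝓞 K) : SL(2, 𝓞 K) :=
  ⟨!![(u : 𝓞 K), b; 0, ((u⁻¹ : (𝓞 K)ˣ) : 𝓞 K)], by simp [Matrix.det_fin_two]⟩

@[simp] theorem upperMat_zero_zero (u : (𝓞 K)ˣ) (b : 𝓞 K) : upperMat u b 0 0 = u := rfl
@[simp] theorem upperMat_zero_one (u : (𝓞 K)ˣ) (b : 𝓞 K) : upperMat u b 0 1 = b := rfl
@[simp] theorem upperMat_one_zero (u : (𝓞 K)ˣ) (b : 𝓞 K) : upperMat u b 1 0 = 0 := rfl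
@[simp] theorem upperMat_one_one (u : (𝓞 K)ˣ) (b : 𝓞 K) :
    upperMat u b 1 1 = ((u⁻¹ : (𝓞 K)ˣ) : 𝓞 K) := rfl

theorem exists_eq_upperMat {A : SL(2, 𝓞 K)} (hA : A 1 0 = 0) : ∃ u b, A = upperMat u b := by
  have hdet : A 0 0 * A 1 1 = 1 := by
    have := A.det_coe
    rwa [Matrix.det_fin_two, hA, mul_zero, sub_zero] at this
  refine ⟨⟨A 0 0, A 1 1, hdet, by rw [mul_comm, hdet]⟩, A 0 1, ?_⟩
  ext i j
  fin_cases i <;> fin_cases j <;> simp [hA]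

theorem upperMat_mem (u : (𝓞 K)ˣ) (b : 𝓞 K) :
    (QuotientGroup.mk (upperMat u b) : ModularGroup K) ∈ stabInfty K :=
  Subgroup.mem_map.2 ⟨upperMat u b, upperMat_one_zero u b, rfl⟩

theorem exists_eq_mk_upperMat {σ : ModularGroup K} (hσ : σ ∈ stabInfty K) :
    ∃ u b, σ = QuotientGroup.mk (upperMat u b) := by
  obtain ⟨A, hA, rfl⟩ := Subgroup.mem_map.1 hσ
  obtain ⟨u, b, rfl⟩ := exists_eq_upperMat hA
  exact ⟨u, b, rfl⟩

theorem neg_one_mem_center : (-1 : SL(2, 𝓞 K)) ∈ Subgroup.center SL(2, 𝓞 K) :=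
  Subgroup.mem_center_iff.2 fun A => by simp

theorem mk_neg (A : SL(2, 𝓞 K)) :
    (QuotientGroup.mk (-A) : ModularGroup K) = QuotientGroup.mk A := by
  rw [QuotientGroup.eq]
  have : (-A)⁻¹ * A = -1 := by
    rw [inv_mul_eq_iff_eq_mul]; simp
  rw [this]
  exact neg_one_mem_center

theorem upperMat_neg (u : (𝓞 K)ˣ) (b : 𝓞 K) : upperMat (-u) (-b) = -upperMat u b := by
  ext i j
  fin_cases i <;> fin_cases j <;> simp

theorem map_unit_ne_zero (φ : K →+* ℝ) (u : (𝓞 K)ˣ) : φ ((u : 𝓞 K) : K) ≠ 0 := by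
  simp

theorem map_inv_unit (φ : K →+* ℝ) (u : (𝓞 K)ˣ) :
    φ (((u⁻¹ : (𝓞 K)ˣ) : 𝓞 K) : K) = (φ ((u : 𝓞 K) : K))⁻¹ := by
  refine eq_inv_of_mul_eq_one_left ?_
  rw [← map_mul, ← map_mul, Units.inv_mul, map_one, map_one]

theorem coe_upperMat_smul (u : (𝓞 K)ˣ) (b : 𝓞 K) (z : HalfSpace K) (φ : K →+* ℝ) :
    ((((QuotientGroup.mk (upperMat u b) : ModularGroup K) • z) φ : ℍ) : ℂ) =
      (φ ((u : 𝓞 K) : K) : ℂ) ^ 2 * (z φ : ℂ) +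
        (φ (((u : 𝓞 K) * b : 𝓞 K) : K) : ℂ) := by
  have h0 : ((φ ((u : 𝓞 K) : K) : ℝ) : ℂ) ≠ 0 := by simp
  rw [mk_smul_apply]
  simp only [upperMat_zero_zero, upperMat_zero_one, upperMat_one_zero, upperMat_one_one,
    map_inv_unit, map_zero, map_mul, Complex.ofReal_zero, Complex.ofReal_inv, Complex.ofReal_mul,
    zero_mul, zero_add]
  field_simp

theorem upperMat_smul_im (u : (𝓞 K)ˣ) (b : 𝓞 K) (z : HalfSpace K) (φ : K →+* ℝ) :
    (((QuotientGroup.mk (upperMat u b) : ModularGroup K) • z) φ).im =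
      φ ((u : 𝓞 K) : K) ^ 2 * (z φ).im := by
  rw [← UpperHalfPlane.coe_im, coe_upperMat_smul, ← Complex.ofReal_pow, Complex.add_im,
    Complex.im_ofReal_mul, Complex.ofReal_im, add_zero, UpperHalfPlane.coe_im]

theorem upperMat_smul_re (u : (𝓞 K)ˣ) (b : 𝓞 K) (z : HalfSpace K) (φ : K →+* ℝ) :
    (((QuotientGroup.mk (upperMat u b) : ModularGroup K) • z) φ).re =
      φ ((u : 𝓞 K) : K) ^ 2 * (z φ).re + φ (((u : 𝓞 K) * b : 𝓞 K) : K) := by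
  rw [← UpperHalfPlane.coe_re, coe_upperMat_smul, ← Complex.ofReal_pow, Complex.add_re,
    Complex.re_ofReal_mul, Complex.ofReal_re, UpperHalfPlane.coe_re]

/-- The automorphy factor `c^{(φ)} z_φ + d^{(φ)}`. -/
def autFactor (c d : 𝓞 K) (z : HalfSpace K) (φ : K →+* ℝ) : ℂ :=
  (φ (c : K) : ℂ) * (z φ : ℂ) + (φ (d : K) : ℂ)

theorem mk_smul_im (A : SL(2, 𝓞 K)) (z : HalfSpace K) (φ : K →+* ℝ) :
    (((QuotientGroup.mk A : ModularGroup K) • z) φ).im =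
      (z φ).im / ‖autFactor (A 1 0) (A 1 1) z φ‖ ^ 2 := by
  change (conj φ A • z φ).im = _
  have := UpperHalfPlane.im_smul_eq_div_normSq (conj φ A : GL (Fin 2) ℝ) (z φ)
  rw [← Complex.normSq_eq_norm_sq]
  refine this.trans ?_
  have hd : ((Matrix.GeneralLinearGroup.det (conj φ A : GL (Fin 2) ℝ) : ℝˣ) : ℝ) = 1 :=
    (conj φ A).det_coe
  rw [hd, abs_one, one_mul]
  rfl

theorem autFactor_unit_mul (u : (𝓞 K)ˣ) (c d : 𝓞 K) (z : HalfSpace K) (φ : K →+* ℝ) :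
    autFactor ((u : 𝓞 K) * c) ((u : 𝓞 K) * d) z φ = φ ((u : 𝓞 K) : K) * autFactor c d z φ := by
  simp [autFactor]
  ring

theorem autFactor_ne_zero {c d : 𝓞 K} (h : ¬ (c = 0 ∧ d = 0)) (z : HalfSpace K) (φ : K →+* ℝ) :
    autFactor c d z φ ≠ 0 := by
  intro h0
  have him := congrArg Complex.im h0
  have hre := congrArg Complex.re h0
  simp [autFactor] at him hre
  have hc : c = 0 := by
    rcases him with h | h
    · exact h
    · exact absurd h (z φ).im_ne_zero
  subst hc
  simp at hre
  exact h ⟨rfl, hre⟩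

theorem bottom_row_ne_zero (A : SL(2, 𝓞 K)) : ¬ (A 1 0 = 0 ∧ A 1 1 = 0) := by
  rintro ⟨h1, h2⟩
  have := A.det_coe
  rw [Matrix.det_fin_two, h1, h2] at this
  simp at this

/-- Matrices with the same lower row define the same coset of `stabInfty`. -/
theorem coset_eq_of_row_eq {A B : SL(2, 𝓞 K)} (h0 : A 1 0 = B 1 0) (h1 : A 1 1 = B 1 1) :
    (Quotient.mk'' (QuotientGroup.mk A : ModularGroup K) : Cosets K) =
      Quotient.mk'' (QuotientGroup.mk B : ModularGroup K) := by
  rw [Quotient.eq'', QuotientGroup.rightRel_apply]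
  refine Subgroup.mem_map.2 ⟨B * A⁻¹, ?_, rfl⟩
  change (B * A⁻¹) 1 0 = 0
  simp [Matrix.mul_apply, Fin.sum_univ_two, Matrix.SpecialLinearGroup.coe_inv,
    Matrix.adjugate_fin_two, h0, h1]
  ring

/-! ### The terms in logarithmic coordinates and their invariance -/

/-- The logarithms of the imaginary parts. -/
def logIm (ψ : Fin n ≃ (K →+* ℝ)) (z : HalfSpace K) (j : Fin n) : ℝ := Real.log (z (ψ j)).im

/-- The function `h(e^{Σ v_j}) e^{i Σ ρ_j v_j}`. -/
def logTerm (ψ : Fin n ≃ (K →+* ℝ)) (ε : Fin (n - 1) → (𝓞 K)ˣ) (h : ℝ → ℂ)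
    (m : Fin (n - 1) → ℤ) (v : Fin n → ℝ) : ℂ :=
  h (Real.exp (∑ j, v j)) * Complex.exp (Complex.I * ((∑ j, rho ψ ε m j * v j : ℝ) : ℂ))

theorem eisensteinTerm_eq (ψ : Fin n ≃ (K →+* ℝ)) (ε : Fin (n - 1) → (𝓞 K)ˣ) (h : ℝ → ℂ)
    (m : Fin (n - 1) → ℤ) (z : HalfSpace K) (γ : ModularGroup K) :
    eisensteinTerm ψ ε h m z γ = logTerm ψ ε h m (logIm ψ (γ • z)) := by
  rw [eisensteinTerm, logTerm, Real.exp_sum]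
  congr 1
  · congr 1
    exact Finset.prod_congr rfl fun j _ => (Real.exp_log ((γ • z) (ψ j)).im_pos).symm
  · rw [Complex.ofReal_sum, Finset.mul_sum, Complex.exp_sum]
    refine Finset.prod_congr rfl fun j _ => ?_
    rw [Complex.cpow_def_of_ne_zero (by exact_mod_cast ((γ • z) (ψ j)).im_ne_zero),
      ← Complex.ofReal_log ((γ • z) (ψ j)).im_pos.le]
    congr 1
    simp only [logIm, Complex.ofReal_mul]
    ring

theorem logIm_upperMat_smul (ψ : Fin n ≃ (K →+* ℝ)) (ε : Fin (n - 1) → (𝓞 K)ˣ)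
    (k : Fin (n - 1) → ℤ) {u : (𝓞 K)ˣ} (hu : u = ∏ q, ε q ^ k q ∨ u = -∏ q, ε q ^ k q)
    (b : 𝓞 K) (z : HalfSpace K) :
    logIm ψ ((QuotientGroup.mk (upperMat u b) : ModularGroup K) • z) =
      logIm ψ z + (2 : ℝ) • Matrix.vecMul (unitCoord k) (unitMatrix ψ ε) := by
  ext j
  rw [logIm, upperMat_smul_im, Real.log_mul (pow_ne_zero _ (map_unit_ne_zero _ _))
    (z (ψ j)).im_ne_zero, Pi.add_apply, Pi.smul_apply, ← log_abs_prod_zpow ψ ε k hu j, ← sq_abs,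
    Real.log_pow, logIm, smul_eq_mul, add_comm]
  simp

theorem sum_unitCoord (ψ : Fin n ≃ (K →+* ℝ)) [NumberField.IsTotallyReal K]
    (ε : Fin (n - 1) → (𝓞 K)ˣ) (k : Fin (n - 1) → ℤ) {u : (𝓞 K)ˣ}
    (hu : u = ∏ q, ε q ^ k q ∨ u = -∏ q, ε q ^ k q) :
    ∑ j, Matrix.vecMul (unitCoord k) (unitMatrix ψ ε) j = 0 := by
  simp_rw [← log_abs_prod_zpow ψ ε k hu]
  rw [← Real.log_prod (fun j _ => abs_ne_zero.2 (map_unit_ne_zero _ _)),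
    ψ.prod_comp (fun φ => |φ ((u : 𝓞 K) : K)|), prod_abs_unit, Real.log_one]

theorem sum_unitCoord_mul_dualCoord (k m : Fin (n - 1) → ℤ) :
    ∑ i, unitCoord k i * dualCoord m i = Real.pi * ((∑ q, k q * m q : ℤ) : ℝ) := by
  rw [sum_castLE (fun i : Fin n => unitCoord k i * dualCoord m i)
    (fun i hi => by simp [unitCoord, hi]), Int.cast_sum, Finset.mul_sum]
  refine Finset.sum_congr rfl fun q _ => ?_
  simp [unitCoord, dualCoord]
  ring

/-- The entries of the shift sum to `0` because units have norm `±1`, so the argument of `h` is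
unchanged; the phase changes by `2π ∑ k_q m_q`. The factor `2` reflects that units act on imaginary
parts through their squares. -/
theorem logTerm_add_unitCoord [NumberField.IsTotallyReal K] (hn : Module.finrank ℚ K = n)
    (ψ : Fin n ≃ (K →+* ℝ)) {ε : Fin (n - 1) → (𝓞 K)ˣ}
    (hε : Subgroup.closure (insert (-1) (Set.range ε)) = ⊤) (h : ℝ → ℂ) (m k : Fin (n - 1) → ℤ)
    (v : Fin n → ℝ) :
    logTerm ψ ε h m (v + (2 : ℝ) • Matrix.vecMul (unitCoord k) (unitMatrix ψ ε)) =
      logTerm ψ ε h m v := by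
  have h1 : ∑ j, (v + (2 : ℝ) • Matrix.vecMul (unitCoord k) (unitMatrix ψ ε)) j = ∑ j, v j := by
    simp only [Pi.add_apply, Pi.smul_apply, Finset.sum_add_distrib, ← Finset.smul_sum,
      sum_unitCoord ψ ε k (Or.inl rfl), smul_zero, add_zero]
  have h2 : ∑ j, rho ψ ε m j *
      (v + (2 : ℝ) • Matrix.vecMul (unitCoord k) (unitMatrix ψ ε)) j =
      ∑ j, rho ψ ε m j * v j + 2 * (Real.pi * ((∑ q, k q * m q : ℤ) : ℝ)) := by
    rw [← sum_unitCoord_mul_dualCoord, ← sum_vecMul_unitMatrix hn ψ hε, Finset.mul_sum,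
      ← Finset.sum_add_distrib]
    refine Finset.sum_congr rfl fun j _ => ?_
    simp only [Pi.add_apply, Pi.smul_apply, smul_eq_mul]
    ring
  rw [logTerm, logTerm, h1, h2, Complex.ofReal_add, mul_add, Complex.exp_add]
  have : Complex.exp (Complex.I *
      ((2 * (Real.pi * ((∑ q, k q * m q : ℤ) : ℝ)) : ℝ) : ℂ)) = 1 := by
    rw [Complex.exp_eq_one_iff]
    refine ⟨∑ q, k q * m q, ?_⟩
    push_cast
    ring
  rw [this, mul_one]

theorem logTerm_logIm_smul [NumberField.IsTotallyReal K] (hn : Module.finrank ℚ K = n)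
    (ψ : Fin n ≃ (K →+* ℝ)) {ε : Fin (n - 1) → (𝓞 K)ˣ}
    (hε : Subgroup.closure (insert (-1) (Set.range ε)) = ⊤) (h : ℝ → ℂ) (m : Fin (n - 1) → ℤ)
    {σ : ModularGroup K} (hσ : σ ∈ stabInfty K) (z : HalfSpace K) :
    logTerm ψ ε h m (logIm ψ (σ • z)) = logTerm ψ ε h m (logIm ψ z) := by
  obtain ⟨u, b, rfl⟩ := exists_eq_mk_upperMat hσ
  obtain ⟨k, hk⟩ := exists_unit_eq_prod_zpow hε u
  rw [logIm_upperMat_smul ψ ε k hk, logTerm_add_unitCoord hn ψ hε]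

theorem eisensteinTerm_mul_left [NumberField.IsTotallyReal K] (hn : Module.finrank ℚ K = n)
    (ψ : Fin n ≃ (K →+* ℝ)) {ε : Fin (n - 1) → (𝓞 K)ˣ}
    (hε : Subgroup.closure (insert (-1) (Set.range ε)) = ⊤) (h : ℝ → ℂ) (m : Fin (n - 1) → ℤ)
    {σ : ModularGroup K} (hσ : σ ∈ stabInfty K) (γ : ModularGroup K) (z : HalfSpace K) :
    eisensteinTerm ψ ε h m z (σ * γ) = eisensteinTerm ψ ε h m z γ := by
  rw [eisensteinTerm_eq, eisensteinTerm_eq, mul_smul, logTerm_logIm_smul hn ψ hε h m hσ]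

theorem eisensteinTerm_out [NumberField.IsTotallyReal K] (hn : Module.finrank ℚ K = n)
    (ψ : Fin n ≃ (K →+* ℝ)) {ε : Fin (n - 1) → (𝓞 K)ˣ}
    (hε : Subgroup.closure (insert (-1) (Set.range ε)) = ⊤) (h : ℝ → ℂ) (m : Fin (n - 1) → ℤ)
    (γ : ModularGroup K) (z : HalfSpace K) :
    eisensteinTerm ψ ε h m z (Quotient.mk'' γ : Cosets K).out = eisensteinTerm ψ ε h m z γ := by
  have hr : (QuotientGroup.rightRel (stabInfty K)) (Quotient.mk'' γ : Cosets K).out γ :=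
    Quotient.mk_out γ
  rw [QuotientGroup.rightRel_apply] at hr
  have := eisensteinTerm_mul_left hn ψ hε h m hr (Quotient.mk'' γ : Cosets K).out z
  rw [← this]
  simp

/-- Right translation of the cosets. -/
def cosetMulRight (γ : ModularGroup K) : Cosets K ≃ Cosets K :=
  Quotient.congr (Equiv.mulRight γ) fun a b => by
    change (QuotientGroup.rightRel _) a b ↔ (QuotientGroup.rightRel _) (a * γ) (b * γ)
    rw [QuotientGroup.rightRel_apply, QuotientGroup.rightRel_apply]
    simp

theorem incompleteEisenstein_smul [NumberField.IsTotallyReal K] (hn : Module.finrank ℚ K = n)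
    (ψ : Fin n ≃ (K →+* ℝ)) {ε : Fin (n - 1) → (𝓞 K)ˣ}
    (hε : Subgroup.closure (insert (-1) (Set.range ε)) = ⊤) (h : ℝ → ℂ) (m : Fin (n - 1) → ℤ)
    (γ : ModularGroup K) (z : HalfSpace K) :
    incompleteEisenstein ψ ε h m (γ • z) = incompleteEisenstein ψ ε h m z := by
  rw [incompleteEisenstein, incompleteEisenstein,
    ← (cosetMulRight γ).tsum_eq (fun c => eisensteinTerm ψ ε h m z c.out)]
  refine tsum_congr fun c => ?_
  induction c using Quotient.inductionOn' with
  | h a =>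
    have : cosetMulRight γ (Quotient.mk'' a) = Quotient.mk'' (a * γ) := rfl
    rw [this, eisensteinTerm_out hn ψ hε, eisensteinTerm_out hn ψ hε, eisensteinTerm_eq,
      eisensteinTerm_eq, smul_smul]

/-! ### Absolute convergence -/

/-- Near `0` this is the decay condition; beyond `δ` it is boundedness together with `y ^ p ≥ δ ^
p`. -/
theorem IsInducing.exists_norm_le {h : ℝ → ℂ} (hh : IsInducing h) (p : ℕ) :
    ∃ C : ℝ, 0 ≤ C ∧ ∀ y : ℝ, 0 < y → ‖h y‖ ≤ C * y ^ p := by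
  obtain ⟨B, hB⟩ := hh.bounded
  have h0 := (hh.decay_zero p).norm
  rw [norm_zero] at h0
  have h1 := h0.eventually (gt_mem_nhds one_pos)
  obtain ⟨δ, hδ, hsub⟩ := mem_nhdsGT_iff_exists_Ioo_subset.1 h1
  have hδ0 : (0 : ℝ) < δ := hδ
  have hB0 : 0 ≤ B := (norm_nonneg _).trans (hB 1 one_pos)
  refine ⟨1 + B / δ ^ p, by positivity, fun y hy => ?_⟩
  have hyp : 0 < y ^ p := by positivity
  rcases lt_or_ge y δ with hlt | hge
  · have := hsub ⟨hy, hlt⟩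
    simp only [Set.mem_ofPred_eq, norm_div, norm_pow, Complex.norm_real, Real.norm_eq_abs,
      abs_of_pos hy, div_lt_one hyp] at this
    have h2 : 0 ≤ B / δ ^ p * y ^ p := by positivity
    linarith
  · calc ‖h y‖ ≤ B := hB y hy
      _ = B / δ ^ p * δ ^ p := by field_simp
      _ ≤ B / δ ^ p * y ^ p := by gcongr
      _ ≤ (1 + B / δ ^ p) * y ^ p := by linarith

theorem norm_logTerm (ψ : Fin n ≃ (K →+* ℝ)) (ε : Fin (n - 1) → (𝓞 K)ˣ) (h : ℝ → ℂ)
    (m : Fin (n - 1) → ℤ) (v : Fin n → ℝ) :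
    ‖logTerm ψ ε h m v‖ = ‖h (Real.exp (∑ j, v j))‖ := by
  rw [logTerm, norm_mul, mul_comm Complex.I, Complex.norm_exp_ofReal_mul_I, mul_one]

theorem norm_eisensteinTerm (ψ : Fin n ≃ (K →+* ℝ)) (ε : Fin (n - 1) → (𝓞 K)ˣ) (h : ℝ → ℂ)
    (m : Fin (n - 1) → ℤ) (z : HalfSpace K) (γ : ModularGroup K) :
    ‖eisensteinTerm ψ ε h m z γ‖ = ‖h (∏ φ, ((γ • z) φ).im)‖ := by
  rw [eisensteinTerm_eq, norm_logTerm, Real.exp_sum, ← ψ.prod_comp (fun φ => ((γ • z) φ).im)]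
  congr 2
  exact Finset.prod_congr rfl fun j _ => Real.exp_log ((γ • z) (ψ j)).im_pos

theorem sum_unitMatrix_row [NumberField.IsTotallyReal K] (ψ : Fin n ≃ (K →+* ℝ))
    (ε : Fin (n - 1) → (𝓞 K)ˣ) (i : Fin n) :
    ∑ j, unitMatrix ψ ε i j = if (i : ℕ) < n - 1 then 0 else (n : ℝ) := by
  split_ifs with hi
  · simp only [unitMatrix, Matrix.of_apply, dif_pos hi]
    rw [← Real.log_prod (fun j _ => abs_ne_zero.2 (map_unit_ne_zero _ _)),
      ψ.prod_comp (fun φ => |φ ((ε ⟨i, hi⟩ : 𝓞 K) : K)|), prod_abs_unit, Real.log_one]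
  · simp [unitMatrix_last ψ ε hi]

/-- Only the last coordinate contributes; the sum over all `i` avoids naming the last index. -/
theorem sum_vecMul_unitMatrix_eq [NumberField.IsTotallyReal K] (ψ : Fin n ≃ (K →+* ℝ))
    (ε : Fin (n - 1) → (𝓞 K)ˣ) (c : Fin n → ℝ) :
    ∑ j, Matrix.vecMul c (unitMatrix ψ ε) j =
      ∑ i : Fin n, if (i : ℕ) < n - 1 then 0 else n * c i := by
  simp only [Matrix.vecMul, dotProduct]
  rw [Finset.sum_comm]
  refine Finset.sum_congr rfl fun i _ => ?_
  rw [← Finset.mul_sum, sum_unitMatrix_row]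
  split_ifs <;> ring

theorem vecMul_inv_unitMatrix [NumberField.IsTotallyReal K] (hn : Module.finrank ℚ K = n)
    (ψ : Fin n ≃ (K →+* ℝ)) {ε : Fin (n - 1) → (𝓞 K)ˣ}
    (hε : Subgroup.closure (insert (-1) (Set.range ε)) = ⊤) (v : Fin n → ℝ) :
    Matrix.vecMul (Matrix.vecMul v (unitMatrix ψ ε)⁻¹) (unitMatrix ψ ε) = v := by
  rw [Matrix.vecMul_vecMul, Matrix.nonsing_inv_mul _
    (isUnit_iff_ne_zero.2 (det_unitMatrix_ne_zero hn ψ hε)), Matrix.vecMul_one]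

/-- Every positive vector can be multiplied by a unit such that its entries become comparable. -/
theorem exists_unit_mul_le [NumberField.IsTotallyReal K] (hn : Module.finrank ℚ K = n)
    (ψ : Fin n ≃ (K →+* ℝ)) {ε : Fin (n - 1) → (𝓞 K)ˣ}
    (hε : Subgroup.closure (insert (-1) (Set.range ε)) = ⊤) :
    ∃ C : ℝ, 0 < C ∧ ∀ a : (K →+* ℝ) → ℝ, (∀ φ, 0 < a φ) → ∃ u : (𝓞 K)ˣ, ∀ φ,
      (|φ ((u : 𝓞 K) : K)| * a φ) ^ n ≤ C * ∏ φ, a φ := by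
  classical
  set M := unitMatrix ψ ε with hM
  refine ⟨Real.exp (n * ∑ i, ∑ j, |M i j|), Real.exp_pos _, fun a ha => ?_⟩
  let l : Fin n → ℝ := fun j => Real.log (a (ψ j))
  let c := Matrix.vecMul l M⁻¹
  have hc : Matrix.vecMul c M = l := vecMul_inv_unitMatrix hn ψ hε l
  -- Multiplication by the unit adds `k_q` to the coordinates of the logarithm vector; this choice
  -- leaves their fractional parts.
  let k : Fin (n - 1) → ℤ := fun q => -⌊c (Fin.castLE (Nat.sub_le n 1) q)⌋
  refine ⟨∏ q, ε q ^ k q, fun φ => ?_⟩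
  obtain ⟨j, rfl⟩ := ψ.surjective φ
  have hk := log_abs_prod_zpow ψ ε k (Or.inl rfl) j
  set u := ∏ q, ε q ^ k q
  have hu := abs_pos.2 (map_unit_ne_zero (ψ j) u)
  have hsum : ∑ j, l j = ∑ i : Fin n, if (i : ℕ) < n - 1 then 0 else n * c i := by
    rw [← sum_vecMul_unitMatrix_eq ψ ε, hc]
  -- The last coordinate accounts for `∑ l_j`; the others lie in `[0, 1)` and contribute at most the
  -- absolute sum of the matrix entries.
  have hle : n * Real.log (|ψ j ((u : 𝓞 K) : K)| * a (ψ j)) ≤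
      n * (∑ i, ∑ j, |M i j|) + ∑ j, l j := by
    have h1 : Real.log (|ψ j ((u : 𝓞 K) : K)| * a (ψ j)) =
        Matrix.vecMul (c + unitCoord k) M j := by
      rw [Real.log_mul hu.ne' (ha _).ne', hk, Matrix.add_vecMul, hc, Pi.add_apply, add_comm]
    rw [h1, hsum, Finset.mul_sum, ← Finset.sum_add_distrib, Matrix.vecMul, dotProduct,
      Finset.mul_sum]
    refine Finset.sum_le_sum fun i _ => ?_
    split_ifs with hi
    · have h2 : (c + unitCoord k) i = Int.fract (c i) := by
        simp only [Pi.add_apply, unitCoord, dif_pos hi, k, Int.fract]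
        push_cast
        rfl
      rw [h2, add_zero]
      refine mul_le_mul_of_nonneg_left ?_ (Nat.cast_nonneg n)
      calc Int.fract (c i) * M i j ≤ 1 * |M i j| :=
            
            (mul_le_mul_of_nonneg_left (le_abs_self _) (Int.fract_nonneg _)).trans
              (mul_le_mul_of_nonneg_right (Int.fract_lt_one _).le (abs_nonneg _))
        _ ≤ ∑ j, |M i j| := by
            rw [one_mul]
            exact Finset.single_le_sum (f := fun j => |M i j|) (fun _ _ => abs_nonneg _)
              (Finset.mem_univ j)
    · have h2 : (c + unitCoord k) i = c i := by simp [unitCoord, hi]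
      rw [h2, hM, unitMatrix_last ψ ε hi, mul_one]
      have : 0 ≤ (n : ℝ) * ∑ j, |unitMatrix ψ ε i j| :=
        mul_nonneg (Nat.cast_nonneg n) (Finset.sum_nonneg fun _ _ => abs_nonneg _)
      linarith
  have hx : 0 < |ψ j ((u : 𝓞 K) : K)| * a (ψ j) := mul_pos hu (ha _)
  have hprod : ∏ φ, a φ = Real.exp (∑ j, l j) := by
    rw [Real.exp_sum, ← ψ.prod_comp]
    exact Finset.prod_congr rfl fun j _ => (Real.exp_log (ha _)).symm
  rw [hprod, ← Real.exp_add]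
  calc (|ψ j ((u : 𝓞 K) : K)| * a (ψ j)) ^ n =
      Real.exp (n * Real.log (|ψ j ((u : 𝓞 K) : K)| * a (ψ j))) := by
        rw [Real.exp_nat_mul, Real.exp_log hx]
    _ ≤ _ := Real.exp_le_exp.2 hle

theorem det_basis_ne_zero [DecidableEq (K →+* ℝ)] {b : Module.Basis (K →+* ℝ) ℤ (𝓞 K)}
    (hb : |(Matrix.of fun i φ : K →+* ℝ => φ (b i : K)).det| =
      Real.sqrt |(NumberField.discr K : ℝ)|) :
    (Matrix.of fun i φ : K →+* ℝ => φ (b i : K)).det ≠ 0 := by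
  rw [← abs_pos, hb, Real.sqrt_pos, abs_pos]
  exact_mod_cast NumberField.discr_ne_zero K

theorem sum_mul_basis (b : Module.Basis (K →+* ℝ) ℤ (𝓞 K)) (c : 𝓞 K) (φ : K →+* ℝ) :
    φ (c : K) = ∑ i, (b.repr c i : ℝ) * φ (b i : K) := by
  conv_lhs => rw [← b.sum_repr c]
  simp

/-- The vectors `b_i z` and `b_i`, which span the lattice of the vectors `c z + d` in `ℂⁿ`. -/
def autBasisVec (b : Module.Basis (K →+* ℝ) ℤ (𝓞 K)) (z : HalfSpace K) :
    (K →+* ℝ) ⊕ (K →+* ℝ) → (K →+* ℝ) → ℂ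
  | Sum.inl i => autFactor (b i) 0 z
  | Sum.inr i => autFactor 0 (b i) z

/-- The imaginary part of a relation involves only the coefficients of the `b_i z`, which vanish
because `det ≠ 0`; the real part then disposes of the rest. -/
theorem linearIndependent_autBasisVec [DecidableEq (K →+* ℝ)]
    {b : Module.Basis (K →+* ℝ) ℤ (𝓞 K)}
    (hb : (Matrix.of fun i φ : K →+* ℝ => φ (b i : K)).det ≠ 0) (z : HalfSpace K) :
    LinearIndependent ℝ (autBasisVec b z) := by
  have hN : ∀ s : (K →+* ℝ) → ℝ, (∀ φ : K →+* ℝ, ∑ i, s i * φ (b i : K) = 0) → s = 0 := by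
    intro s hs
    exact Matrix.eq_zero_of_vecMul_eq_zero hb (funext fun φ => hs φ)
  rw [Fintype.linearIndependent_iff]
  intro g hg
  have him : (fun i => g (Sum.inl i)) = 0 := by
    refine hN _ fun φ => ?_
    have := congrArg Complex.im (congrFun hg φ)
    simp only [Fintype.sum_sum_type, autBasisVec, autFactor, Finset.sum_apply,
      Pi.smul_apply, Complex.add_im, Complex.im_sum, Complex.smul_im, Complex.im_ofReal_mul,
      Complex.ofReal_im, smul_eq_mul, Pi.zero_apply, Complex.zero_im, UpperHalfPlane.coe_im,
      map_zero, Complex.ofReal_zero, zero_mul, add_zero, mul_zero, Finset.sum_const_zero,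
      zero_add, ← mul_assoc, ← Finset.sum_mul] at this
    exact (mul_eq_zero.1 this).resolve_right (z φ).im_ne_zero
  have hre : (fun i => g (Sum.inr i)) = 0 := by
    refine hN _ fun φ => ?_
    have := congrArg Complex.re (congrFun hg φ)
    simp only [Fintype.sum_sum_type, autBasisVec, autFactor, Finset.sum_apply,
      Pi.smul_apply, congrFun him, Pi.zero_apply, zero_smul, Finset.sum_const_zero, zero_add,
      map_zero, Complex.ofReal_zero, zero_mul, Complex.re_sum, Complex.smul_re,
      Complex.ofReal_re, smul_eq_mul, Complex.zero_re] at this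
    exact this
  rintro (i | i)
  · exact congrFun him i
  · exact congrFun hre i

theorem autFactor_mem_span (b : Module.Basis (K →+* ℝ) ℤ (𝓞 K)) (z : HalfSpace K) (c d : 𝓞 K) :
    autFactor c d z ∈ Submodule.span ℤ (Set.range (autBasisVec b z)) := by
  have : autFactor c d z = ∑ i, b.repr c i • autBasisVec b z (Sum.inl i) +
      ∑ i, b.repr d i • autBasisVec b z (Sum.inr i) := by
    ext φ
    simp only [autFactor, sum_mul_basis b c φ, sum_mul_basis b d φ, autBasisVec, Pi.add_apply,
      Finset.sum_apply, Complex.ofReal_sum, Complex.ofReal_mul, Complex.ofReal_intCast,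
      Finset.sum_mul, mul_assoc]
    simp [autFactor]
  rw [this]
  exact add_mem
    (sum_mem fun i _ => Submodule.smul_mem _ _ (Submodule.subset_span ⟨_, rfl⟩))
    (sum_mem fun i _ => Submodule.smul_mem _ _ (Submodule.subset_span ⟨_, rfl⟩))

theorem summable_norm_pow_inv_of_mem_span {ι E α : Type*} [Fintype ι] [NormedAddCommGroup E]
    [NormedSpace ℝ E] (B : Module.Basis ι ℝ E) {p : ℕ} (hp : Fintype.card ι < p)
    {f : α → E} (hf : Function.Injective f)
    (hmem : ∀ a, f a ∈ Submodule.span ℤ (Set.range B)) : Summable fun a => ‖f a‖⁻¹ ^ p := by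
  have : FiniteDimensional ℝ E := B.finiteDimensional_of_finite
  have hrank : Module.finrank ℤ (Submodule.span ℤ (Set.range B)) = Fintype.card ι :=
    Module.finrank_eq_card_basis (B.restrictScalars ℤ)
  have hs := ZLattice.summable_norm_pow_inv (Submodule.span ℤ (Set.range B)) p (by rwa [hrank])
  have hg : Function.Injective
      (fun a => (⟨f a, hmem a⟩ : Submodule.span ℤ (Set.range B))) :=
    fun a a' h => hf (congrArg Subtype.val h)
  simpa only [Function.comp_def, Submodule.coe_norm] using hs.comp_injective hg

/-- The vectors `cz + d` are distinct points of a lattice of rank `2n` in `ℂⁿ`. The pair `(0, 0)`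
does no harm since `0⁻¹ = 0`. -/
theorem summable_norm_autFactor (hn : Module.finrank ℚ K = n)
    (ψ : Fin n ≃ (K →+* ℝ)) (z : HalfSpace K) (p : ℕ) (hp : 2 * n < p) :
    Summable fun cd : 𝓞 K × 𝓞 K => ‖autFactor cd.1 cd.2 z‖⁻¹ ^ p := by
  classical
  have hpos := finrank_pos_of_eq hn
  obtain ⟨b, hb⟩ := exists_integral_basis hn ψ
  have hli := linearIndependent_autBasisVec (det_basis_ne_zero hb) z
  have hcard : Fintype.card ((K →+* ℝ) ⊕ (K →+* ℝ)) = Module.finrank ℝ ((K →+* ℝ) → ℂ) := by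
    rw [Module.finrank_pi_fintype, Fintype.card_sum]
    simp [Complex.finrank_real_complex, mul_two]
  have : Nonempty ((K →+* ℝ) ⊕ (K →+* ℝ)) := ⟨Sum.inl (ψ ⟨0, hpos⟩)⟩
  let B := basisOfLinearIndependentOfCardEqFinrank hli hcard
  have hB : ⇑B = autBasisVec b z := coe_basisOfLinearIndependentOfCardEqFinrank hli hcard
  refine summable_norm_pow_inv_of_mem_span B (p := p)
    (f := fun cd : 𝓞 K × 𝓞 K => autFactor cd.1 cd.2 z)
    (by rwa [Fintype.card_sum, card_embeddings ψ, ← two_mul]) ?_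
    (fun cd => by rw [hB]; exact autFactor_mem_span b z _ _)
  rintro ⟨c, d⟩ ⟨c', d'⟩ h
  have h1 : autFactor (c - c') (d - d') z = 0 := by
    have : autFactor c d z = autFactor c' d' z := h
    ext φ
    have := congrFun this φ
    simp only [autFactor] at this
    simp only [autFactor, map_sub, Complex.ofReal_sub, Pi.zero_apply]
    linear_combination this
  by_contra hne
  refine autFactor_ne_zero (c := c - c') (d := d - d') ?_ z (ψ ⟨0, hpos⟩) (congrFun h1 _)
  rintro ⟨h2, h3⟩
  exact hne (Prod.ext (sub_eq_zero.1 h2) (sub_eq_zero.1 h3))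

/-- Every coset has a representative for which the entries of the automorphy factor are
comparable. -/
theorem exists_reduced_row [NumberField.IsTotallyReal K] (hn : Module.finrank ℚ K = n)
    (ψ : Fin n ≃ (K →+* ℝ)) {ε : Fin (n - 1) → (𝓞 K)ˣ}
    (hε : Subgroup.closure (insert (-1) (Set.range ε)) = ⊤) (z : HalfSpace K) :
    ∃ C : ℝ, 0 < C ∧ ∀ c : Cosets K, ∃ A : SL(2, 𝓞 K), c = Quotient.mk'' (QuotientGroup.mk A) ∧
      ‖autFactor (A 1 0) (A 1 1) z‖ ^ n ≤ C * ∏ φ, ‖autFactor (A 1 0) (A 1 1) z φ‖ := by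
  have hpos := finrank_pos_of_eq hn
  obtain ⟨C, hC, hu⟩ := exists_unit_mul_le hn ψ hε
  have : Nonempty (K →+* ℝ) := ⟨ψ ⟨0, hpos⟩⟩
  refine ⟨C, hC, fun c => ?_⟩
  induction c using Quotient.inductionOn' with
  | h γ =>
    obtain ⟨A, rfl⟩ := QuotientGroup.mk_surjective γ
    obtain ⟨u, hu⟩ := hu (fun φ => ‖autFactor (A 1 0) (A 1 1) z φ‖)
      (fun φ => norm_pos_iff.2 (autFactor_ne_zero (bottom_row_ne_zero A) z φ))
    -- The lower right entry of `upperMat u⁻¹ 0` is `u`, so the lower row is scaled by `u` within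
    -- the same coset.
    have h0 : (upperMat u⁻¹ 0 * A) 1 0 = (u : 𝓞 K) * A 1 0 := by
      simp [Matrix.mul_apply, Fin.sum_univ_two]
    have h1 : (upperMat u⁻¹ 0 * A) 1 1 = (u : 𝓞 K) * A 1 1 := by
      simp [Matrix.mul_apply, Fin.sum_univ_two]
    refine ⟨upperMat u⁻¹ 0 * A, ?_, ?_⟩
    · rw [Quotient.eq'', QuotientGroup.rightRel_apply, QuotientGroup.mk_mul, mul_inv_cancel_right]
      exact upperMat_mem _ _
    · rw [h0, h1]
      have hnorm : ∀ φ, ‖autFactor ((u : 𝓞 K) * A 1 0) ((u : 𝓞 K) * A 1 1) z φ‖ =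
          |φ ((u : 𝓞 K) : K)| * ‖autFactor (A 1 0) (A 1 1) z φ‖ := fun φ => by
        rw [autFactor_unit_mul, norm_mul, Complex.norm_real, Real.norm_eq_abs]
      simp_rw [hnorm]
      rw [Finset.prod_mul_distrib, prod_abs_unit, one_mul]
      -- The norm on the product is the sup norm, so it is attained at a single embedding.
      obtain ⟨φ, -, hφ⟩ := Finset.exists_max_image Finset.univ
        (fun φ => ‖autFactor ((u : 𝓞 K) * A 1 0) ((u : 𝓞 K) * A 1 1) z φ‖) Finset.univ_nonempty
      have hle : ‖autFactor ((u : 𝓞 K) * A 1 0) ((u : 𝓞 K) * A 1 1) z‖ ≤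
          |φ ((u : 𝓞 K) : K)| * ‖autFactor (A 1 0) (A 1 1) z φ‖ := by
        rw [← hnorm, pi_norm_le_iff_of_nonneg (norm_nonneg _)]
        exact fun φ' => hφ φ' (Finset.mem_univ _)
      exact (pow_le_pow_left₀ (norm_nonneg _) hle n).trans (hu φ)

/-- For a reduced row with norm `x` and product `P`, the argument of `h` is `Y / P²`, where `Y = ∏
y_φ`, and `P⁻¹ ≤ C x⁻ⁿ`. So `‖h(y)‖ ≤ D y²` bounds the term by `D Y² C⁴ x^{-4n}`, and `4n` exceeds
the rank `2n`. -/
theorem summable_norm_eisensteinTerm [NumberField.IsTotallyReal K] (hn : Module.finrank ℚ K = n)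
    (ψ : Fin n ≃ (K →+* ℝ)) {ε : Fin (n - 1) → (𝓞 K)ˣ}
    (hε : Subgroup.closure (insert (-1) (Set.range ε)) = ⊤) {h : ℝ → ℂ} (hh : IsInducing h)
    (m : Fin (n - 1) → ℤ) (z : HalfSpace K) :
    Summable fun c : Cosets K => ‖eisensteinTerm ψ ε h m z c.out‖ := by
  have hpos := finrank_pos_of_eq hn
  obtain ⟨C, hC, hA⟩ := exists_reduced_row hn ψ hε z
  choose A hcA hA using hA
  obtain ⟨D, hD, hDh⟩ := hh.exists_norm_le 2
  have hinj : Function.Injective fun c => (A c 1 0, A c 1 1) := by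
    intro c c' hcc
    rw [hcA c, hcA c']
    exact coset_eq_of_row_eq (congrArg Prod.fst hcc) (congrArg Prod.snd hcc)
  have hs := (summable_norm_autFactor hn ψ z (4 * n) (by omega)).comp_injective hinj
  refine Summable.of_nonneg_of_le (fun _ => norm_nonneg _) (fun c => ?_)
    (hs.mul_left (D * ((∏ φ, (z φ).im) ^ 2 * C ^ 4)))
  have hout : ‖eisensteinTerm ψ ε h m z c.out‖ =
      ‖eisensteinTerm ψ ε h m z (QuotientGroup.mk (A c))‖ := by
    conv_lhs => rw [hcA c]
    rw [eisensteinTerm_out hn ψ hε]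
  have hne : autFactor (A c 1 0) (A c 1 1) z ≠ 0 := fun h0 =>
    autFactor_ne_zero (bottom_row_ne_zero (A c)) z (ψ ⟨0, hpos⟩) (congrFun h0 _)
  have hx : 0 < ‖autFactor (A c 1 0) (A c 1 1) z‖ := norm_pos_iff.2 hne
  set x := ‖autFactor (A c 1 0) (A c 1 1) z‖ with hxdef
  have hP : 0 < ∏ φ, ‖autFactor (A c 1 0) (A c 1 1) z φ‖ := Finset.prod_pos fun φ _ =>
    norm_pos_iff.2 (autFactor_ne_zero (bottom_row_ne_zero (A c)) z φ)
  have hAc := hA c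
  set P := ∏ φ, ‖autFactor (A c 1 0) (A c 1 1) z φ‖ with hPdef
  have hY : 0 < ∏ φ, (z φ).im := Finset.prod_pos fun φ _ => (z φ).im_pos
  have him : ∏ φ, (((QuotientGroup.mk (A c) : ModularGroup K) • z) φ).im =
      (∏ φ, (z φ).im) / P ^ 2 := by
    simp_rw [mk_smul_im]
    rw [Finset.prod_div_distrib, Finset.prod_pow]
  rw [hout, norm_eisensteinTerm, him]
  refine (hDh _ (by positivity)).trans ?_
  rw [mul_assoc]
  refine mul_le_mul_of_nonneg_left ?_ hD
  rw [div_pow, div_eq_mul_inv, mul_assoc]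
  refine mul_le_mul_of_nonneg_left ?_ (by positivity)
  change ((P ^ 2) ^ 2)⁻¹ ≤ C ^ 4 * (x⁻¹ ^ (4 * n))
  rw [inv_pow, ← div_eq_mul_inv, le_div_iff₀ (by positivity), ← pow_mul, inv_mul_eq_div,
    div_le_iff₀ (by positivity), ← mul_pow, mul_comm 4 n, pow_mul]
  exact pow_le_pow_left₀ (by positivity) hAc 4

/-! ### Existence of a fundamental domain for the modular group -/

open scoped Pointwise in
/-- A countable group which acts properly discontinuously and almost everywhere freely has a
fundamental domain. -/
theorem exists_isFundamentalDomain_of_finite {G X : Type*} [Group G] [MulAction G X]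
    [TopologicalSpace X] [T2Space X] [SecondCountableTopology X] [MeasurableSpace X]
    [BorelSpace X] [ContinuousConstSMul G X] [Countable G] (μ : Measure X)
    (hfree : ∀ᵐ x ∂μ, ∀ g : G, g ≠ 1 → g • x ≠ x)
    (hfin : ∀ x : X, ∃ V ∈ 𝓝 x, {g : G | ∃ y ∈ V, g • y ∈ V}.Finite) :
    ∃ F : Set X, IsFundamentalDomain G F μ := by
  -- A point with trivial stabilizer has a neighbourhood disjoint from its translates: only finitely
  -- many `g` matter, and each is handled by separating `x` from `g • x`.
  have hnhd : ∀ x : X, (∀ g : G, g ≠ 1 → g • x ≠ x) →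
      ∃ U ∈ 𝓝 x, ∀ g : G, g ≠ 1 → ∀ y ∈ U, g • y ∉ U := by
    intro x hx
    obtain ⟨V, hV, hS⟩ := hfin x
    have hW : ∀ g : G, ∃ W ∈ 𝓝 x, g ≠ 1 → ∀ y ∈ W, g • y ∉ W := by
      intro g
      by_cases hg : g = 1
      · exact ⟨Set.univ, univ_mem, fun h => absurd hg h⟩
      · obtain ⟨A, B, hA, hB, hgA, hxB, hAB⟩ := t2_separation (hx g hg)
        refine ⟨(fun y => g • y) ⁻¹' A ∩ B, inter_mem
          ((continuous_const_smul g).continuousAt.preimage_mem_nhds (hA.mem_nhds hgA))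
          (hB.mem_nhds hxB), fun _ y hy hgy => ?_⟩
        exact Set.disjoint_left.1 hAB hy.1 hgy.2
    choose W hWx hW using hW
    refine ⟨V ∩ ⋂ g ∈ {g : G | ∃ y ∈ V, g • y ∈ V}, W g,
      inter_mem hV ((biInter_mem hS).2 fun g _ => hWx g), fun g hg y hy hgy => ?_⟩
    have hmem : g ∈ {g : G | ∃ y ∈ V, g • y ∈ V} := ⟨y, hy.1, hgy.1⟩
    exact hW g hg y (Set.mem_iInter₂.1 hy.2 g hmem) (Set.mem_iInter₂.1 hgy.2 g hmem)
  let S : Set (Set X) :=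
    {U ∈ TopologicalSpace.countableBasis X | ∀ g : G, g ≠ 1 → ∀ y ∈ U, g • y ∉ U}
  -- The empty set is added so that the family is nonempty and can be enumerated by `ℕ`.
  have hSc : (insert ∅ S).Countable :=
    ((TopologicalSpace.countable_countableBasis X).mono fun U hU => hU.1).insert ∅
  obtain ⟨U, hU⟩ := hSc.exists_eq_range ⟨∅, Set.mem_insert _ _⟩
  have hUo : ∀ i, IsOpen (U i) := fun i => by
    have : U i ∈ insert ∅ S := hU ▸ Set.mem_range_self i
    rcases this with h | h
    · rw [h]; exact isOpen_empty
    · exact TopologicalSpace.isOpen_of_mem_countableBasis h.1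
  have hUd : ∀ i, ∀ g : G, g ≠ 1 → ∀ y ∈ U i, g • y ∉ U i := fun i => by
    have : U i ∈ insert ∅ S := hU ▸ Set.mem_range_self i
    rcases this with h | h
    · rw [h]; simp
    · exact h.2
  have hUx : ∀ x : X, (∀ g : G, g ≠ 1 → g • x ≠ x) → ∃ i, x ∈ U i := by
    intro x hx
    obtain ⟨W, hW, hWd⟩ := hnhd x hx
    obtain ⟨V, hV, hxV, hVW⟩ :=
      (TopologicalSpace.isBasis_countableBasis X).mem_nhds_iff.1 hW
    have : V ∈ Set.range U := hU ▸ Set.mem_insert_of_mem _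
      ⟨hV, fun g hg y hy hgy => hWd g hg y (hVW hy) (hVW hgy)⟩
    obtain ⟨i, rfl⟩ := this
    exact ⟨i, hxV⟩
  -- From each `U i` keep the points whose orbit misses all earlier `U j`: an orbit meeting some `U
  -- i` is then represented exactly once, in the first one it meets.
  let F : Set X := ⋃ i, U i \ ⋃ j, ⋃ (_ : j < i), ⋃ g : G, (fun y => g • y) ⁻¹' U j
  have hF : ∀ x, x ∈ F ↔ ∃ i, x ∈ U i ∧ ∀ j < i, ∀ g : G, g • x ∉ U j := fun x => by
    simp [F]
  refine ⟨F, ?_, ?_, ?_⟩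
  · refine (MeasurableSet.iUnion fun i => (hUo i).measurableSet.diff ?_).nullMeasurableSet
    refine MeasurableSet.iUnion fun j => MeasurableSet.iUnion fun _ =>
      MeasurableSet.iUnion fun g => ((hUo j).preimage (continuous_const_smul g)).measurableSet
  · filter_upwards [hfree] with x hx
    classical
    have hex : ∃ i, ∃ g : G, g • x ∈ U i := by
      obtain ⟨i, hi⟩ := hUx x hx
      exact ⟨i, 1, by rwa [one_smul]⟩
    obtain ⟨g, hg⟩ := Nat.find_spec hex
    refine ⟨g, (hF _).2 ⟨_, hg, fun j hj g' hg' => Nat.find_min hex hj ⟨g' * g, ?_⟩⟩⟩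
    rwa [mul_smul]
  · intro g g' hgg'
    refine Disjoint.aedisjoint (Set.disjoint_left.2 fun y hy hy' => ?_)
    rw [Set.mem_smul_set_iff_inv_smul_mem, hF] at hy hy'
    obtain ⟨i, hi, hmin⟩ := hy
    obtain ⟨i', hi', hmin'⟩ := hy'
    have hii : i = i' := by
      rcases lt_trichotomy i i' with h | h | h
      · exact absurd hi (by simpa [smul_smul] using hmin' i h (g⁻¹ * g'))
      · exact h
      · exact absurd hi' (by simpa [smul_smul] using hmin i' h (g'⁻¹ * g))
    subst hii
    refine hUd i (g'⁻¹ * g) (fun h => hgg' ?_) (g⁻¹ • y) hi (by simpa [smul_smul] using hi')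
    exact (inv_mul_eq_one.1 h).symm

instance countable_ringOfIntegers : Countable (𝓞 K) :=
  (NumberField.RingOfIntegers.basis K).equivFun.toEquiv.countable_iff.2 inferInstance

instance countable_specialLinearGroup : Countable SL(2, 𝓞 K) := by
  have : Countable (Matrix (Fin 2) (Fin 2) (𝓞 K)) :=
    inferInstanceAs (Countable (Fin 2 → Fin 2 → 𝓞 K))
  exact Subtype.countable

instance countable_modularGroup : Countable (ModularGroup K) :=
  QuotientGroup.mk_surjective.countable

theorem mk_smul_eq (A : SL(2, 𝓞 K)) (z : HalfSpace K) :
    (QuotientGroup.mk A : ModularGroup K) • z = fun φ => conj φ A • z φ := rfl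

instance continuousConstSMul_modularGroup :
    ContinuousConstSMul (ModularGroup K) (HalfSpace K) where
  continuous_const_smul γ := by
    obtain ⟨A, rfl⟩ := QuotientGroup.mk_surjective γ
    simp only [mk_smul_eq]
    exact continuous_pi fun φ => (continuous_const_smul (conj φ A)).comp (continuous_apply φ)

instance smulInvariantMeasure_modularGroup :
    SMulInvariantMeasure (ModularGroup K) (HalfSpace K) volume where
  measure_preimage_smul γ s hs := by
    obtain ⟨A, rfl⟩ := QuotientGroup.mk_surjective γ
    have : MeasurePreserving (fun z : HalfSpace K => (QuotientGroup.mk A : ModularGroup K) • z)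
        volume volume := by
      simp only [mk_smul_eq]
      refine measurePreserving_pi (fun _ : K →+* ℝ => (volume : Measure ℍ)) (fun _ => volume)
        (f := fun φ w => conj φ A • w) fun φ => ?_
      exact measurePreserving_smul (conj φ A : GL (Fin 2) ℝ) (volume : Measure ℍ)
    exact this.measure_preimage hs.nullMeasurableSet

instance nullSingletonClass_upperHalfPlane : NullSingletonClass (volume : Measure ℍ) where
  measure_singleton w := by
    rw [UpperHalfPlane.volume_eq_lintegral, Set.image_singleton]
    simp

/-- Every complex absolute value of `K` comes from a real embedding, so this is the finiteness of
algebraic integers with bounded conjugates. -/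
theorem finite_forall_abs_le [NumberField.IsTotallyReal K] (B : ℝ) :
    {x : 𝓞 K | ∀ φ : K →+* ℝ, |φ (x : K)| ≤ B}.Finite := by
  refine ((NumberField.Embeddings.finite_of_norm_le K ℂ B).preimage
    (f := fun x : 𝓞 K => (x : K)) NumberField.RingOfIntegers.coe_injective.injOn).subset ?_
  intro x hx
  refine ⟨x.isIntegral_coe, fun σ => ?_⟩
  obtain ⟨φ, hφ⟩ := placeOf_bijective.2 (NumberField.InfinitePlace.mk σ)
  rw [← NumberField.InfinitePlace.apply, ← hφ, placeOf_apply]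
  exact hx φ

/-- The imaginary part of `cw + d` controls `c`, and then `d` is a difference of bounded quantities,
uniformly for `w` in a box. -/
theorem abs_le_of_norm_affine_le {c d R S : ℝ} (hR : 0 < R) {w : ℍ} (hre : |w.re| ≤ R)
    (him1 : R⁻¹ ≤ w.im) (him2 : w.im ≤ R) (h : ‖(c : ℂ) * w + d‖ ≤ S) :
    |c| ≤ R * S ∧ |d| ≤ S + R * S * (2 * R) := by
  have h1 : |c| * w.im ≤ S := by
    have := (Complex.abs_im_le_norm ((c : ℂ) * w + d)).trans h
    simpa [abs_mul, abs_of_pos w.im_pos] using this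
  have hc : |c| ≤ R * S := by
    have h2 : |c| * R⁻¹ ≤ S := (mul_le_mul_of_nonneg_left him1 (abs_nonneg c)).trans h1
    rw [← div_eq_mul_inv, div_le_iff₀ hR] at h2
    linarith
  have hw : ‖(w : ℂ)‖ ≤ 2 * R := by
    refine (Complex.norm_le_abs_re_add_abs_im _).trans ?_
    rw [UpperHalfPlane.coe_re, UpperHalfPlane.coe_im, abs_of_pos w.im_pos]
    linarith
  refine ⟨hc, ?_⟩
  have h3 : (d : ℂ) = ((c : ℂ) * w + d) - (c : ℂ) * w := by ring
  rw [← Real.norm_eq_abs, ← Complex.norm_real, h3]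
  refine (norm_sub_le _ _).trans (add_le_add h ?_)
  rw [norm_mul, Complex.norm_real, Real.norm_eq_abs]
  exact mul_le_mul hc hw (norm_nonneg _) ((abs_nonneg c).trans hc)

/-- If `w` and `γw` lie in a box, the formula for `Im γw` bounds `cw + d`, and `aw + b = (γw)(cw +
d)` is bounded too. All conjugates of all matrix entries are then bounded, leaving finitely many
matrices. -/
theorem exists_nhds_finite [NumberField.IsTotallyReal K] (z : HalfSpace K) :
    ∃ V ∈ 𝓝 z, {γ : ModularGroup K | ∃ w ∈ V, γ • w ∈ V}.Finite := by
  let R : ℝ := 1 + ∑ φ, (|(z φ).re| + (z φ).im + ((z φ).im)⁻¹)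
  have hpos : ∀ φ, 0 ≤ |(z φ).re| + (z φ).im + ((z φ).im)⁻¹ := fun φ => by
    have := (z φ).im_pos
    positivity
  have hR : 0 < R := add_pos_of_pos_of_nonneg one_pos (Finset.sum_nonneg fun φ _ => hpos φ)
  have hlt : ∀ φ, |(z φ).re| + (z φ).im + ((z φ).im)⁻¹ < R := fun φ =>
    (Finset.single_le_sum (f := fun φ => |(z φ).re| + (z φ).im + ((z φ).im)⁻¹)
      (fun φ _ => hpos φ) (Finset.mem_univ φ)).trans_lt (lt_one_add _)
  let V : Set (HalfSpace K) := {w | ∀ φ, |(w φ).re| < R ∧ R⁻¹ < (w φ).im ∧ (w φ).im < R}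
  have hVo : IsOpen V := by
    simp only [V, Set.ofPred_forall]
    refine isOpen_iInter_of_finite fun φ => ?_
    have hre : Continuous fun w : HalfSpace K => (w φ).re :=
      UpperHalfPlane.continuous_re.comp (continuous_apply φ)
    have him : Continuous fun w : HalfSpace K => (w φ).im :=
      UpperHalfPlane.continuous_im.comp (continuous_apply φ)
    exact (isOpen_lt hre.abs continuous_const).inter
      ((isOpen_lt continuous_const him).inter (isOpen_lt him continuous_const))
  have hzV : z ∈ V := fun φ => by
    have h1 := hlt φ
    have h2 := (z φ).im_pos
    have h3 : 0 < ((z φ).im)⁻¹ := inv_pos.2 h2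
    have h4 := abs_nonneg (z φ).re
    exact ⟨by linarith, by rw [inv_lt_comm₀ hR h2]; linarith, by linarith⟩
  refine ⟨V, hVo.mem_nhds hzV, ?_⟩
  -- The sum of the bounds for `d`, `b`, `c` and `a`, in this order.
  let B : ℝ := R + R * R * (2 * R) + (2 * R * R + R * (2 * R * R) * (2 * R)) + R * R +
    R * (2 * R * R)
  have hfin := finite_forall_abs_le (K := K) B
  set T : Set (𝓞 K) := {x : 𝓞 K | ∀ φ : K →+* ℝ, |φ (x : K)| ≤ B} with hT
  have hM : {A : SL(2, 𝓞 K) | ∀ i j, A i j ∈ T}.Finite := by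
    have : {f : Fin 2 → Fin 2 → 𝓞 K | ∀ i j, f i j ∈ T}.Finite := by
      have := Set.Finite.pi' (ι := Fin 2) (t := fun _ => {g : Fin 2 → 𝓞 K | ∀ j, g j ∈ T})
        fun _ => Set.Finite.pi' fun _ => hfin
      exact this
    exact this.preimage (f := fun A : SL(2, 𝓞 K) => fun i j => A i j)
      fun A _ A' _ h => Subtype.ext h
  refine (hM.image (QuotientGroup.mk : SL(2, 𝓞 K) → ModularGroup K)).subset ?_
  rintro γ ⟨w, hw, hγw⟩
  obtain ⟨A, rfl⟩ := QuotientGroup.mk_surjective γ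
  refine ⟨A, ?_, rfl⟩
  have hcd : ∀ φ, ‖autFactor (A 1 0) (A 1 1) w φ‖ ≤ R := fun φ => by
    have h1 := mk_smul_im A w φ
    have h2 := (hγw φ).2.1
    have h3 := (hw φ).2.2
    have hne := norm_pos_iff.2 (autFactor_ne_zero (bottom_row_ne_zero A) w φ)
    rw [h1, lt_div_iff₀ (by positivity), inv_mul_lt_iff₀ hR] at h2
    refine le_of_lt (lt_of_pow_lt_pow_left₀ 2 hR.le (h2.trans ?_))
    nlinarith
  have hab : ∀ φ, ‖autFactor (A 0 0) (A 0 1) w φ‖ ≤ 2 * R * R := fun φ => by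
    have hne := autFactor_ne_zero (bottom_row_ne_zero A) w φ
    have h1 := mk_smul_apply A w φ
    have h2 : autFactor (A 0 0) (A 0 1) w φ =
        ((((QuotientGroup.mk A : ModularGroup K) • w) φ : ℍ) : ℂ) *
          autFactor (A 1 0) (A 1 1) w φ := by
      rw [h1]
      exact (div_mul_cancel₀ _ hne).symm
    rw [h2, norm_mul]
    refine mul_le_mul ?_ (hcd φ) (norm_nonneg _) (by positivity)
    refine (Complex.norm_le_abs_re_add_abs_im _).trans ?_
    have h3 := hγw φ
    rw [UpperHalfPlane.coe_re, UpperHalfPlane.coe_im, abs_of_pos (UpperHalfPlane.im_pos _)]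
    linarith [h3.1, h3.2.2]
  have hCD := fun φ => abs_le_of_norm_affine_le hR (hw φ).1.le (hw φ).2.1.le (hw φ).2.2.le (hcd φ)
  have hAB := fun φ => abs_le_of_norm_affine_le hR (hw φ).1.le (hw φ).2.1.le (hw φ).2.2.le (hab φ)
  have p1 : 0 < R * R := by positivity
  have p2 : 0 < R * R * (2 * R) := by positivity
  have p3 : 0 < R * (2 * R * R) := by positivity
  have p4 : 0 < R * (2 * R * R) * (2 * R) := by positivity
  have p5 : 0 < 2 * R * R := by positivity
  intro i j φ
  fin_cases i <;> fin_cases j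
  · exact (hAB φ).1.trans (by simp only [B]; linarith)
  · exact (hAB φ).2.trans (by simp only [B]; linarith)
  · exact (hCD φ).1.trans (by simp only [B]; linarith)
  · exact (hCD φ).2.trans (by simp only [B]; linarith)

theorem finite_setOf_quadratic_eq_zero {a b c : ℝ} (h : ¬ (a = 0 ∧ b = 0 ∧ c = 0)) :
    {w : ℍ | (a : ℂ) * (w : ℂ) ^ 2 + b * w + c = 0}.Finite := by
  let p : Polynomial ℂ := Polynomial.C (a : ℂ) * Polynomial.X ^ 2 +
    Polynomial.C (b : ℂ) * Polynomial.X + Polynomial.C (c : ℂ)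
  have hp : p ≠ 0 := by
    intro hp
    refine h ⟨?_, ?_, ?_⟩
    · have := congrArg (fun q => Polynomial.coeff q 2) hp
      simpa [p, Polynomial.coeff_X, Polynomial.coeff_C] using this
    · have := congrArg (fun q => Polynomial.coeff q 1) hp
      simpa [p, Polynomial.coeff_X, Polynomial.coeff_C] using this
    · have := congrArg (fun q => Polynomial.coeff q 0) hp
      simpa [p, Polynomial.coeff_X, Polynomial.coeff_C] using this
  refine ((Polynomial.finite_setOfPred_isRoot hp).preimage
    (f := UpperHalfPlane.coe) UpperHalfPlane.coe_injective.injOn).subset ?_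
  intro w hw
  simpa [p, Polynomial.IsRoot] using hw

/-- In one coordinate a fixed point satisfies `c w² + (d - a) w - b = 0`, which is a nontrivial
equation unless the matrix is scalar. So each `γ ≠ 1` fixes only points over a finite set, and the
group is countable. -/
theorem ae_smul_ne [Nonempty (K →+* ℝ)] :
    ∀ᵐ z : HalfSpace K, ∀ γ : ModularGroup K, γ ≠ 1 → γ • z ≠ z := by
  rw [ae_all_iff]
  intro γ
  by_cases hγ : γ = 1
  · exact .of_forall fun z h => absurd hγ h
  obtain ⟨A, rfl⟩ := QuotientGroup.mk_surjective γ
  obtain ⟨φ⟩ := ‹Nonempty (K →+* ℝ)›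
  have hne : ¬ (φ (A 1 0 : K) = 0 ∧ φ (A 1 1 : K) - φ (A 0 0 : K) = 0 ∧ -φ (A 0 1 : K) = 0) := by
    rintro ⟨h1, h2, h3⟩
    refine hγ ((QuotientGroup.eq_one_iff A).2 ?_)
    have h1' : A 1 0 = 0 := by simpa using h1
    have h3' : A 0 1 = 0 := by simpa using h3
    have h2' : A 1 1 = A 0 0 := by
      have := φ.injective (sub_eq_zero.1 h2)
      exact_mod_cast this
    have hd := A.det_coe
    rw [Matrix.det_fin_two, h1', h2', mul_zero, sub_zero] at hd
    refine Matrix.SpecialLinearGroup.mem_center_iff.2 ⟨A 0 0, by simpa [sq] using hd, ?_⟩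
    ext i j
    fin_cases i <;> fin_cases j <;> simp [h1', h2', h3']
  have hfin := finite_setOf_quadratic_eq_zero hne
  have hnull := hfin.measure_zero (volume : Measure ℍ)
  have hae : ∀ᵐ z : HalfSpace K, z φ ∉ {w : ℍ | ((φ (A 1 0 : K) : ℝ) : ℂ) * (w : ℂ) ^ 2 +
      ((φ (A 1 1 : K) - φ (A 0 0 : K) : ℝ) : ℂ) * w + ((-φ (A 0 1 : K) : ℝ) : ℂ) = 0} :=
    (Measure.quasiMeasurePreserving_eval (fun _ : K →+* ℝ => (volume : Measure ℍ)) φ).ae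
      (measure_eq_zero_iff_ae_notMem.1 hnull)
  filter_upwards [hae] with z hz _ hfix
  refine hz ?_
  have h1 := mk_smul_apply A z φ
  rw [hfix] at h1
  have h0 := autFactor_ne_zero (bottom_row_ne_zero A) z φ
  rw [autFactor] at h0
  rw [eq_div_iff h0] at h1
  change _ = _
  push_cast
  linear_combination h1

theorem exists_isFundamentalDomain_modularGroup [NumberField.IsTotallyReal K]
    [Nonempty (K →+* ℝ)] :
    ∃ 𝓕 : Set (HalfSpace K), IsFundamentalDomain (ModularGroup K) 𝓕 volume :=
  exists_isFundamentalDomain_of_finite volume ae_smul_ne exists_nhds_finite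

/-! ### The invariant measure in the coordinates `x + i e^v` -/

/-- The coordinates `(x, v) ↦ x + i e^v` of the upper half plane. -/
def expChart : ℝ × ℝ ≃ᵐ ℍ where
  toFun p := ⟨⟨p.1, Real.exp p.2⟩, Real.exp_pos _⟩
  invFun z := (z.re, Real.log z.im)
  left_inv p := by
    ext
    · rfl
    · exact Real.log_exp p.2
  right_inv z := by
    apply UpperHalfPlane.ext
    exact Complex.ext rfl (Real.exp_log z.im_pos)
  measurable_toFun := by
    refine measurable_comap_iff.2 ?_
    exact Complex.measurableEquivRealProd.symm.measurable.comp
      (measurable_fst.prodMk (Real.measurable_exp.comp measurable_snd))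
  measurable_invFun := UpperHalfPlane.continuous_re.measurable.prodMk
    (Real.measurable_log.comp UpperHalfPlane.continuous_im.measurable)

/-- The measure `e^{-v} dv` on the real line. -/
def expMeasure : Measure ℝ := volume.withDensity fun v => ENNReal.ofReal (Real.exp (-v))

instance sigmaFinite_expMeasure : SigmaFinite expMeasure := by
  unfold expMeasure
  exact SigmaFinite.withDensity_ofReal _

theorem lintegral_Ioi_eq_exp (f : ℝ → ENNReal) :
    ∫⁻ y in Set.Ioi 0, f y = ∫⁻ v, ENNReal.ofReal (Real.exp v) * f (Real.exp v) := by
  have h := lintegral_image_eq_lintegral_abs_deriv_mul (s := Set.univ) MeasurableSet.univ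
    (fun x _ => (Real.hasDerivAt_exp x).hasDerivWithinAt) Real.exp_injective.injOn f
  rw [Set.image_univ, Real.range_exp] at h
  simpa [abs_of_pos (Real.exp_pos _)] using h

/-- For `y = e^v` one has `dy / y² = e^{-v} dv`; the substitution is made on each vertical line. -/
theorem measurePreserving_expChart :
    MeasurePreserving expChart (volume.prod expMeasure) volume := by
  refine ⟨expChart.measurable, Measure.ext fun s hs => ?_⟩
  have hcs : MeasurableSet (UpperHalfPlane.coe '' s) :=
    UpperHalfPlane.measurableEmbedding_coe.measurableSet_image.2 hs
  have hpre : MeasurableSet (expChart ⁻¹' s) := expChart.measurable hs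
  have hmeas : Measurable fun z : ℂ => (((1 / ‖z.im‖₊) ^ 2 : NNReal) : ENNReal) := by
    fun_prop
  have hF : Measurable ((UpperHalfPlane.coe '' s).indicator
      fun z : ℂ => (((1 / ‖z.im‖₊) ^ 2 : NNReal) : ENNReal)) := hmeas.indicator hcs
  rw [Measure.map_apply expChart.measurable hs, Measure.prod_apply hpre,
    UpperHalfPlane.volume_eq_lintegral, ← lintegral_indicator hcs,
    ← Complex.volume_preserving_equiv_real_prod.symm.lintegral_comp hF,
    Measure.volume_eq_prod]
  refine Eq.trans ?_ (lintegral_prod _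
    (hF.comp Complex.measurableEquivRealProd.symm.measurable).aemeasurable).symm
  simp only [Function.comp_apply]
  refine lintegral_congr fun x => ?_
  rw [expMeasure, withDensity_apply _ (measurable_prodMk_left hpre),
    ← lintegral_indicator (measurable_prodMk_left hpre)]
  -- The image of `s` lies in the upper half plane, so the integral over the line reduces to `y >
  -- 0`, where the substitution applies.
  have hzero : ∀ y : ℝ, y ∉ Set.Ioi (0 : ℝ) → (UpperHalfPlane.coe '' s).indicator
      (fun z : ℂ => (((1 / ‖z.im‖₊) ^ 2 : NNReal) : ENNReal))
        (Complex.measurableEquivRealProd.symm (x, y)) = 0 := by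
    intro y hy
    refine Set.indicator_of_notMem ?_ _
    rintro ⟨w, -, hw⟩
    have := congrArg Complex.im hw
    have h2 : w.im = y := this
    exact hy (h2 ▸ w.im_pos)
  symm
  rw [← setLIntegral_eq_of_support_subset (s := Set.Ioi 0) (fun y hy => by
    by_contra h; exact hy (hzero y h)), lintegral_Ioi_eq_exp]
  refine lintegral_congr fun v => ?_
  have hiff : Complex.measurableEquivRealProd.symm (x, Real.exp v) ∈ UpperHalfPlane.coe '' s ↔
      v ∈ Prod.mk x ⁻¹' (expChart ⁻¹' s) := by
    constructor
    · rintro ⟨w, hw, hwe⟩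
      have : w = expChart (x, v) := UpperHalfPlane.ext hwe
      change expChart (x, v) ∈ s
      rwa [← this]
    · exact fun h => ⟨_, h, rfl⟩
  by_cases hv : v ∈ Prod.mk x ⁻¹' (expChart ⁻¹' s)
  · rw [Set.indicator_of_mem hv, Set.indicator_of_mem (hiff.2 hv)]
    have him : (Complex.measurableEquivRealProd.symm (x, Real.exp v)).im = Real.exp v := rfl
    rw [him, ← ENNReal.ofReal_coe_nnreal, ← ENNReal.ofReal_mul (Real.exp_pos v).le]
    congr 1
    simp only [NNReal.coe_pow, NNReal.coe_div, NNReal.coe_one, coe_nnnorm, Real.norm_eq_abs,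
      abs_of_pos (Real.exp_pos v), Real.exp_neg]
    have := (Real.exp_pos v).ne'
    field_simp
  · rw [Set.indicator_of_notMem hv, Set.indicator_of_notMem (fun h => hv (hiff.1 h)), mul_zero]

theorem lintegral_fin_prod_eq_prod {n : ℕ} (f : Fin n → ℝ → ENNReal) (hf : ∀ i, Measurable (f i)) :
    ∫⁻ x : Fin n → ℝ, ∏ i, f i (x i) = ∏ i, ∫⁻ t, f i t := by
  induction n with
  | zero => simp [volume_pi]
  | succ n ih =>
    have hp := (volume_preserving_piFinSuccAbove (fun _ : Fin (n + 1) => ℝ) 0).symm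
    have hm : Measurable fun x : Fin (n + 1) → ℝ => ∏ i, f i (x i) :=
      Finset.measurable_prod _ fun i _ => (hf i).comp (measurable_pi_apply i)
    have hm' : Measurable fun x : Fin n → ℝ => ∏ i : Fin n, f i.succ (x i) :=
      Finset.measurable_prod _ fun i _ => (hf i.succ).comp (measurable_pi_apply i)
    rw [← hp.lintegral_comp hm, Fin.prod_univ_succ, ← ih (fun i => f i.succ) fun i => hf _,
      ← lintegral_prod_mul (hf 0).aemeasurable hm'.aemeasurable]
    refine lintegral_congr fun p => ?_
    rw [Fin.prod_univ_succ]
    simp [MeasurableEquiv.piFinSuccAbove]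

theorem lintegral_fintype_prod_eq_prod {ι : Type*} [Fintype ι] (f : ι → ℝ → ENNReal)
    (hf : ∀ i, Measurable (f i)) :
    ∫⁻ x : ι → ℝ, ∏ i, f i (x i) = ∏ i, ∫⁻ t, f i t := by
  let e := (Fintype.equivFin ι).symm
  have hm : Measurable fun x : ι → ℝ => ∏ i, f i (x i) :=
    Finset.measurable_prod _ fun i _ => (hf i).comp (measurable_pi_apply i)
  rw [← (volume_measurePreserving_piCongrLeft (fun _ : ι => ℝ) e).lintegral_comp hm,
    ← e.prod_comp, ← lintegral_fin_prod_eq_prod _ fun i => hf _]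
  refine lintegral_congr fun x => ?_
  rw [← e.prod_comp]
  refine Finset.prod_congr rfl fun i _ => ?_
  congr 1
  exact Equiv.piCongrLeft_apply_apply (fun _ : ι => ℝ) e x i

theorem pi_expMeasure {ι : Type*} [Fintype ι] :
    Measure.pi (fun _ : ι => expMeasure) =
      (volume : Measure (ι → ℝ)).withDensity
        fun v => ENNReal.ofReal (Real.exp (-∑ i, v i)) := by
  have hexp : Measurable fun v : ℝ => ENNReal.ofReal (Real.exp (-v)) := by fun_prop
  refine Measure.pi_eq fun s hs => ?_
  rw [withDensity_apply _ (MeasurableSet.univ_pi hs),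
    ← lintegral_indicator (MeasurableSet.univ_pi hs)]
  simp only [expMeasure, withDensity_apply _ (hs _), ← lintegral_indicator (hs _)]
  rw [← lintegral_fintype_prod_eq_prod _ fun i => hexp.indicator (hs i)]
  refine lintegral_congr fun v => ?_
  by_cases hv : v ∈ Set.univ.pi s
  · rw [Set.indicator_of_mem hv, ← Finset.sum_neg_distrib, Real.exp_sum,
      ENNReal.ofReal_prod_of_nonneg fun i _ => (Real.exp_pos _).le]
    exact Finset.prod_congr rfl fun i _ =>
      (Set.indicator_of_mem (hv i (Set.mem_univ i)) (fun t => ENNReal.ofReal (Real.exp (-t)))).symm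
  · rw [Set.indicator_of_notMem hv]
    simp only [Set.mem_univ_pi, not_forall] at hv
    obtain ⟨i, hi⟩ := hv
    exact (Finset.prod_eq_zero (Finset.mem_univ i) (Set.indicator_of_notMem hi _)).symm

variable (K) in
/-- The coordinates `(x, v) ↦ x + i e^v` of the product of half planes. -/
def halfSpaceChart : ((K →+* ℝ) → ℝ) × ((K →+* ℝ) → ℝ) ≃ᵐ HalfSpace K :=
  (MeasurableEquiv.arrowProdEquivProdArrow ℝ ℝ (K →+* ℝ)).symm.trans
    (MeasurableEquiv.piCongrRight fun _ => expChart)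

theorem halfSpaceChart_im (p : ((K →+* ℝ) → ℝ) × ((K →+* ℝ) → ℝ)) (φ : K →+* ℝ) :
    (halfSpaceChart K p φ).im = Real.exp (p.2 φ) := rfl

theorem measurePreserving_halfSpaceChart :
    MeasurePreserving (halfSpaceChart K)
      ((volume : Measure ((K →+* ℝ) → ℝ)).prod ((volume : Measure ((K →+* ℝ) → ℝ)).withDensity
        fun v => ENNReal.ofReal (Real.exp (-∑ φ, v φ)))) volume := by
  rw [← pi_expMeasure]
  have h1 := (measurePreserving_arrowProdEquivProdArrow ℝ ℝ (K →+* ℝ)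
    (fun _ => volume) (fun _ => expMeasure)).symm
  exact (measurePreserving_pi _ _ fun _ : K →+* ℝ => measurePreserving_expChart).comp h1

/-! ### One-dimensional integrals -/

/-- On `(0, 1]` use `h(w) = O(w²)`; on `(1, ∞)` boundedness of `h` suffices. -/
theorem IsInducing.integrableOn_div_sq {h : ℝ → ℂ} (hh : IsInducing h) :
    IntegrableOn (fun w : ℝ => h w / (w : ℂ) ^ 2) (Set.Ioi 0) := by
  have hcont : ContinuousOn (fun w : ℝ => h w / (w : ℂ) ^ 2) (Set.Ioi 0) := by
    refine hh.smooth.continuousOn.div (by fun_prop) fun w hw => ?_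
    exact pow_ne_zero _ (Complex.ofReal_ne_zero.2 (ne_of_gt hw))
  obtain ⟨C, hC, hCh⟩ := hh.exists_norm_le 2
  obtain ⟨B, hB⟩ := hh.bounded
  have hnorm : ∀ w : ℝ, 0 < w → ‖h w / (w : ℂ) ^ 2‖ = ‖h w‖ / w ^ 2 := fun w hw => by
    rw [norm_div, norm_pow, Complex.norm_real, Real.norm_eq_abs, abs_of_pos hw]
  rw [← Set.Ioc_union_Ioi_eq_Ioi zero_le_one]
  refine IntegrableOn.union ?_ ?_
  · refine IntegrableOn.of_bound (C := C) (by simp)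
      ((hcont.mono Set.Ioc_subset_Ioi_self).aestronglyMeasurable measurableSet_Ioc) ?_
    refine (ae_restrict_iff' measurableSet_Ioc).2 (.of_forall fun w hw => ?_)
    rw [hnorm w hw.1, div_le_iff₀ (pow_pos hw.1 2)]
    exact hCh w hw.1
  · have hi : IntegrableOn (fun w : ℝ => B * w ^ (-2 : ℝ)) (Set.Ioi 1) :=
      (integrableOn_Ioi_rpow_of_lt (by norm_num) one_pos).const_mul B
    refine Integrable.mono' hi ((hcont.mono (Set.Ioi_subset_Ioi zero_le_one)).aestronglyMeasurable
      measurableSet_Ioi) ?_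
    refine (ae_restrict_iff' measurableSet_Ioi).2 (.of_forall fun w hw => ?_)
    have hw0 : 0 < w := one_pos.trans hw
    rw [hnorm w hw0, div_eq_mul_inv, Real.rpow_neg hw0.le, Real.rpow_two]
    exact mul_le_mul_of_nonneg_right (hB w hw0) (by positivity)

theorem exp_smul_div_sq (h : ℝ → ℂ) (s : ℝ) :
    |Real.exp s| • (h (Real.exp s) / ((Real.exp s : ℝ) : ℂ) ^ 2) =
      h (Real.exp s) * Complex.exp (-(s : ℂ)) := by
  have := Complex.exp_ne_zero (s : ℂ)
  rw [abs_of_pos (Real.exp_pos s), Complex.real_smul, Complex.exp_neg, Complex.ofReal_exp]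
  field_simp

theorem IsInducing.integrable_comp_exp {h : ℝ → ℂ} (hh : IsInducing h) :
    Integrable fun s : ℝ => h (Real.exp s) * Complex.exp (-(s : ℂ)) := by
  have := integrableOn_image_iff_integrableOn_abs_deriv_smul (s := Set.univ) MeasurableSet.univ
    (fun x _ => (Real.hasDerivAt_exp x).hasDerivWithinAt) Real.exp_injective.injOn
    (fun w : ℝ => h w / (w : ℂ) ^ 2)
  rw [Set.image_univ, Real.range_exp, integrableOn_univ] at this
  simp_rw [← exp_smul_div_sq]
  exact this.1 hh.integrableOn_div_sq

theorem integral_comp_exp (h : ℝ → ℂ) :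
    ∫ s : ℝ, h (Real.exp s) * Complex.exp (-(s : ℂ)) =
      ∫ w in Set.Ioi (0 : ℝ), h w / (w : ℂ) ^ 2 := by
  have := integral_image_eq_integral_abs_deriv_smul (s := Set.univ) MeasurableSet.univ
    (fun x _ => (Real.hasDerivAt_exp x).hasDerivWithinAt) Real.exp_injective.injOn
    (fun w : ℝ => h w / (w : ℂ) ^ 2)
  rw [Set.image_univ, Real.range_exp, setIntegral_univ] at this
  simp_rw [← exp_smul_div_sq]
  exact this.symm

/-- For `k ≠ 0` the interval `[0, 2)` is a whole number of periods of `exp(iπkt)`. This is the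
source of the vanishing for `m ≠ 0`. -/
theorem integral_Ico_exp_int (k : ℤ) :
    ∫ t in Set.Ico (0 : ℝ) 2, Complex.exp (Complex.I * ((t * (Real.pi * k) : ℝ) : ℂ)) =
      if k = 0 then 2 else 0 := by
  rw [integral_Ico_eq_integral_Ioc, ← intervalIntegral.integral_of_le zero_le_two]
  split_ifs with hk
  · simp [hk]
  · have hc : Complex.I * (Real.pi * k : ℂ) ≠ 0 :=
      mul_ne_zero Complex.I_ne_zero (mul_ne_zero (by exact_mod_cast Real.pi_ne_zero)
        (by exact_mod_cast hk))
    have : (fun t : ℝ => Complex.exp (Complex.I * ((t * (Real.pi * k) : ℝ) : ℂ))) =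
        fun t : ℝ => Complex.exp (Complex.I * (Real.pi * k : ℂ) * t) := by
      ext t
      congr 1
      push_cast
      ring
    rw [this, integral_exp_mul_complex hc]
    have h1 : Complex.exp (Complex.I * (Real.pi * k : ℂ) * (2 : ℝ)) = 1 := by
      rw [Complex.exp_eq_one_iff]
      exact ⟨k, by push_cast; ring⟩
    rw [h1]
    simp

/-- The factor belonging to the `i`-th coordinate of the function `logTerm` in the coordinates given
by the rows of the unit matrix. -/
def sliceFn (h : ℝ → ℂ) (m : Fin (n - 1) → ℤ) (i : Fin n) (t : ℝ) : ℂ :=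
  if hi : (i : ℕ) < n - 1 then
    (Set.Ico (0 : ℝ) 2).indicator
      (fun t => Complex.exp (Complex.I * ((t * (Real.pi * m ⟨i, hi⟩) : ℝ) : ℂ))) t
  else h (Real.exp (n * t)) * Complex.exp (-((n * t : ℝ) : ℂ))

theorem integrable_sliceFn {h : ℝ → ℂ} (hh : IsInducing h) (m : Fin (n - 1) → ℤ) (i : Fin n) :
    Integrable (sliceFn h m i) := by
  by_cases hi : (i : ℕ) < n - 1
  · have : sliceFn h m i = (Set.Ico (0 : ℝ) 2).indicator
        (fun t => Complex.exp (Complex.I * ((t * (Real.pi * m ⟨i, hi⟩) : ℝ) : ℂ))) := by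
      ext t; simp only [sliceFn, dif_pos hi]
    rw [this, integrable_indicator_iff measurableSet_Ico]
    refine (Continuous.integrableOn_Icc ?_).mono_set Set.Ico_subset_Icc_self
    fun_prop
  · have : sliceFn h m i =
        fun t => h (Real.exp (n * t)) * Complex.exp (-((n * t : ℝ) : ℂ)) := by
      ext t; simp only [sliceFn, dif_neg hi]
    rw [this]
    have hn0 : (n : ℝ) ≠ 0 := by
      have := i.2
      exact Nat.cast_ne_zero.2 (by omega)
    exact hh.integrable_comp_exp.comp_mul_left' hn0

theorem integral_sliceFn (h : ℝ → ℂ) (m : Fin (n - 1) → ℤ) (i : Fin n) :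
    ∫ t, sliceFn h m i t = if hi : (i : ℕ) < n - 1 then (if m ⟨i, hi⟩ = 0 then 2 else 0)
      else (n : ℂ)⁻¹ * ∫ w in Set.Ioi (0 : ℝ), h w / (w : ℂ) ^ 2 := by
  split_ifs with hi hm
  · simp only [sliceFn, dif_pos hi]
    rw [integral_indicator measurableSet_Ico, integral_Ico_exp_int, if_pos hm]
  · simp only [sliceFn, dif_pos hi]
    rw [integral_indicator measurableSet_Ico, integral_Ico_exp_int, if_neg hm]
  · simp only [sliceFn, dif_neg hi]
    -- The substitution `s = nt` produces the factor `n⁻¹`.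
    have := Measure.integral_comp_mul_left
      (fun s : ℝ => h (Real.exp s) * Complex.exp (-(s : ℂ))) (n : ℝ)
    rw [this, integral_comp_exp, Complex.real_smul, abs_of_nonneg (by positivity)]
    push_cast
    rfl

theorem prod_integral_sliceFn_of_ne (h : ℝ → ℂ) {m : Fin (n - 1) → ℤ} (hm : m ≠ 0) :
    ∏ i, ∫ t, sliceFn h m i t = 0 := by
  obtain ⟨q, hq⟩ := Function.ne_iff.1 hm
  refine Finset.prod_eq_zero (Finset.mem_univ (Fin.castLE (Nat.sub_le n 1) q)) ?_
  rw [integral_sliceFn]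
  have : m q ≠ 0 := hq
  simp [this]

theorem prod_integral_sliceFn_zero (hn : 0 < n) (h : ℝ → ℂ) :
    ∏ i, ∫ t, sliceFn h (0 : Fin (n - 1) → ℤ) i t =
      2 ^ (n - 1) * ((n : ℂ)⁻¹ * ∫ w in Set.Ioi (0 : ℝ), h w / (w : ℂ) ^ 2) := by
  obtain ⟨k, rfl⟩ : ∃ k, n = k + 1 := ⟨n - 1, by omega⟩
  simp only [integral_sliceFn, Pi.zero_apply, if_true, Fin.prod_univ_castSucc]
  simp

/-! ### The integral over the strip -/

/-- The vectors whose coordinates, except the last one, lie in `[0, 2)`. -/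
def strip (n : ℕ) : Set (Fin n → ℝ) := {c | ∀ i : Fin n, (i : ℕ) < n - 1 → c i ∈ Set.Ico (0 : ℝ) 2}

theorem measurableSet_strip : MeasurableSet (strip n) := by
  simp only [strip, Set.ofPred_forall]
  exact MeasurableSet.iInter fun i => MeasurableSet.iInter fun _ =>
    measurable_pi_apply i measurableSet_Ico

/-- The function `logTerm` on the vectors with coordinates in the strip, with the density
`e^{-Σ v_j}`. -/
def stripFn (ψ : Fin n ≃ (K →+* ℝ)) (ε : Fin (n - 1) → (𝓞 K)ˣ) (h : ℝ → ℂ)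
    (m : Fin (n - 1) → ℤ) (v : Fin n → ℝ) : ℂ :=
  {v | Matrix.vecMul v (unitMatrix ψ ε)⁻¹ ∈ strip n}.indicator
    (fun v => Real.exp (-∑ j, v j) • logTerm ψ ε h m v) v

/-- In the coordinates `c`, the entries of the vector sum to `n` times the last coordinate, its
pairing with `ρ(m)` is `π ∑ m_q c_q`, and the strip is a product set; hence the function factors. -/
theorem stripFn_vecMul [NumberField.IsTotallyReal K] (hn : Module.finrank ℚ K = n)
    (ψ : Fin n ≃ (K →+* ℝ)) {ε : Fin (n - 1) → (𝓞 K)ˣ}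
    (hε : Subgroup.closure (insert (-1) (Set.range ε)) = ⊤) (h : ℝ → ℂ) (m : Fin (n - 1) → ℤ)
    (c : Fin n → ℝ) :
    stripFn ψ ε h m (Matrix.vecMul c (unitMatrix ψ ε)) = ∏ i, sliceFn h m i (c i) := by
  have hpos := finrank_pos_of_eq hn
  have hinv : Matrix.vecMul (Matrix.vecMul c (unitMatrix ψ ε)) (unitMatrix ψ ε)⁻¹ = c := by
    rw [Matrix.vecMul_vecMul, Matrix.mul_nonsing_inv _
      (isUnit_iff_ne_zero.2 (det_unitMatrix_ne_zero hn ψ hε)), Matrix.vecMul_one]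
  by_cases hc : c ∈ strip n
  · have hmem : Matrix.vecMul c (unitMatrix ψ ε) ∈
        {v | Matrix.vecMul v (unitMatrix ψ ε)⁻¹ ∈ strip n} := by
      change _ ∈ strip n
      rwa [hinv]
    rw [stripFn, Set.indicator_of_mem hmem, logTerm, sum_vecMul_unitMatrix hn ψ hε,
      sum_vecMul_unitMatrix_eq]
    let l : Fin n := ⟨n - 1, by omega⟩
    have hl : ¬ (l : ℕ) < n - 1 := lt_irrefl _
    have hlt : ∀ i : Fin n, i ≠ l → (i : ℕ) < n - 1 := fun i hi => by
      have h2 : (i : ℕ) ≠ n - 1 := fun h => hi (Fin.ext h)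
      have := i.2
      omega
    have hsum : ∑ i : Fin n, (if (i : ℕ) < n - 1 then 0 else n * c i) = n * c l := by
      rw [Finset.sum_eq_single l (fun i _ hi => if_pos (hlt i hi)) (by simp), if_neg hl]
    -- `dualCoord` vanishes at the last index, so the exponential may be written uniformly for all
    -- `i`.
    have hslice : ∀ i, sliceFn h m i (c i) =
        Complex.exp (Complex.I * ((c i * dualCoord m i : ℝ) : ℂ)) *
        if (i : ℕ) < n - 1 then 1 else
          h (Real.exp (n * c i)) * Complex.exp (-((n * c i : ℝ) : ℂ)) := by
      intro i
      by_cases hi : (i : ℕ) < n - 1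
      · simp only [sliceFn, dif_pos hi, dualCoord, if_pos hi]
        rw [Set.indicator_of_mem (hc i hi), mul_one]
      · simp [sliceFn, dualCoord, hi]
    rw [hsum, Finset.prod_congr rfl fun i _ => hslice i, Finset.prod_mul_distrib,
      ← Complex.exp_sum, ← Finset.mul_sum, ← Complex.ofReal_sum,
      Finset.prod_eq_single (f := fun i : Fin n => if (i : ℕ) < n - 1 then (1 : ℂ) else
          h (Real.exp (n * c i)) * Complex.exp (-((n * c i : ℝ) : ℂ))) l
        (fun i _ hi => if_pos (hlt i hi)) (by simp), if_neg hl, Complex.real_smul,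
      Complex.ofReal_exp]
    push_cast
    ring
  · have hmem : Matrix.vecMul c (unitMatrix ψ ε) ∉
        {v | Matrix.vecMul v (unitMatrix ψ ε)⁻¹ ∈ strip n} := by
      change _ ∉ strip n
      rwa [hinv]
    rw [stripFn, Set.indicator_of_notMem hmem]
    simp only [strip, Set.mem_ofPred_eq, not_forall] at hc
    obtain ⟨i, hi, hci⟩ := hc
    refine (Finset.prod_eq_zero (Finset.mem_univ i) ?_).symm
    rw [sliceFn, dif_pos hi, Set.indicator_of_notMem hci]

theorem map_vecMul_volume {M : Matrix (Fin n) (Fin n) ℝ} (hM : M.det ≠ 0) :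
    Measure.map (fun c => Matrix.vecMul c M) volume = ENNReal.ofReal |M.det⁻¹| • volume := by
  have := Real.map_matrix_volume_pi_eq_smul_volume_pi (M := M.transpose)
    (by rwa [Matrix.det_transpose])
  rw [Matrix.det_transpose] at this
  rw [← this]
  congr 1
  ext c
  rw [Matrix.toLin'_apply, Matrix.mulVec_transpose]

theorem measurableEmbedding_vecMul {M : Matrix (Fin n) (Fin n) ℝ} (hM : M.det ≠ 0) :
    MeasurableEmbedding fun c : Fin n → ℝ => Matrix.vecMul c M := by
  have hu : IsUnit M.det := isUnit_iff_ne_zero.2 hM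
  have hcont : ∀ N : Matrix (Fin n) (Fin n) ℝ,
      Continuous fun c : Fin n → ℝ => Matrix.vecMul c N := fun N => by
    exact Continuous.matrix_vecMul continuous_id continuous_const
  let e : (Fin n → ℝ) ≃ₜ (Fin n → ℝ) :=
    { toFun := fun c => Matrix.vecMul c M
      invFun := fun c => Matrix.vecMul c M⁻¹
      left_inv := fun c => by
        simp only [Matrix.vecMul_vecMul, Matrix.mul_nonsing_inv _ hu, Matrix.vecMul_one]
      right_inv := fun c => by
        simp only [Matrix.vecMul_vecMul, Matrix.nonsing_inv_mul _ hu, Matrix.vecMul_one]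
      continuous_toFun := hcont M
      continuous_invFun := hcont M⁻¹ }
  exact e.measurableEmbedding

theorem integrable_comp_vecMul_iff {M : Matrix (Fin n) (Fin n) ℝ} (hM : M.det ≠ 0)
    (f : (Fin n → ℝ) → ℂ) : Integrable (fun c => f (Matrix.vecMul c M)) ↔ Integrable f := by
  have h1 := (measurableEmbedding_vecMul hM).integrable_map_iff (g := f) (μ := volume)
  rw [map_vecMul_volume hM, integrable_smul_measure (by simpa using hM) (by simp)] at h1
  exact h1.symm

theorem integral_eq_abs_det_mul {M : Matrix (Fin n) (Fin n) ℝ} (hM : M.det ≠ 0)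
    (f : (Fin n → ℝ) → ℂ) : ∫ v, f v = |M.det| * ∫ c, f (Matrix.vecMul c M) := by
  have h1 := (measurableEmbedding_vecMul hM).integral_map f (μ := volume)
  rw [map_vecMul_volume hM, integral_smul_measure, ENNReal.toReal_ofReal (abs_nonneg _)] at h1
  rw [← h1, Complex.real_smul, ← mul_assoc, ← Complex.ofReal_mul, ← abs_mul,
    mul_inv_cancel₀ hM]
  simp

theorem integrable_stripFn [NumberField.IsTotallyReal K] (hn : Module.finrank ℚ K = n)
    (ψ : Fin n ≃ (K →+* ℝ)) {ε : Fin (n - 1) → (𝓞 K)ˣ}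
    (hε : Subgroup.closure (insert (-1) (Set.range ε)) = ⊤) {h : ℝ → ℂ} (hh : IsInducing h)
    (m : Fin (n - 1) → ℤ) : Integrable (stripFn ψ ε h m) := by
  rw [← integrable_comp_vecMul_iff (det_unitMatrix_ne_zero hn ψ hε)]
  simp_rw [stripFn_vecMul hn ψ hε]
  exact Integrable.fintype_prod fun i => integrable_sliceFn hh m i

theorem integral_stripFn [NumberField.IsTotallyReal K] (hn : Module.finrank ℚ K = n)
    (ψ : Fin n ≃ (K →+* ℝ)) {ε : Fin (n - 1) → (𝓞 K)ˣ}
    (hε : Subgroup.closure (insert (-1) (Set.range ε)) = ⊤) (h : ℝ → ℂ)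
    (m : Fin (n - 1) → ℤ) : ∫ v, stripFn ψ ε h m v =
      ((n * NumberField.Units.regulator K : ℝ) : ℂ) * ∏ i, ∫ t, sliceFn h m i t := by
  rw [integral_eq_abs_det_mul (det_unitMatrix_ne_zero hn ψ hε), abs_det_unitMatrix hn ψ hε]
  simp_rw [stripFn_vecMul hn ψ hε]
  rw [integral_fintype_prod_volume_eq_prod]

/-! ### A fundamental domain for the stabilizer of `∞` and the integral over it -/

/-- The ring of integers as a lattice in `ℝⁿ`, with its covolume. -/
theorem exists_basis_integers (hn : Module.finrank ℚ K = n) (ψ : Fin n ≃ (K →+* ℝ)) :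
    ∃ B : Module.Basis (K →+* ℝ) ℝ ((K →+* ℝ) → ℝ),
      (∀ x : (K →+* ℝ) → ℝ, x ∈ Submodule.span ℤ (Set.range B) ↔
        ∃ a : 𝓞 K, ∀ φ, x φ = φ (a : K)) ∧
      volume (ZSpan.fundamentalDomain B) =
        ENNReal.ofReal (Real.sqrt |(NumberField.discr K : ℝ)|) := by
  classical
  obtain ⟨b, hb⟩ := exists_integral_basis hn ψ
  have : Nonempty (K →+* ℝ) := ⟨ψ ⟨0, finrank_pos_of_eq hn⟩⟩
  have hli : LinearIndependent ℝ fun i φ : K →+* ℝ => φ (b i : K) :=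
    Matrix.linearIndependent_rows_of_det_ne_zero (det_basis_ne_zero hb)
  let B := basisOfLinearIndependentOfCardEqFinrank hli (by simp)
  have hB : ∀ i φ, B i φ = φ (b i : K) := fun i φ => by
    rw [coe_basisOfLinearIndependentOfCardEqFinrank hli]
  refine ⟨B, fun x => ⟨fun hx => ?_, ?_⟩, ?_⟩
  · induction hx using Submodule.span_induction with
    | mem x hx =>
      obtain ⟨i, rfl⟩ := hx
      exact ⟨b i, hB i⟩
    | zero => exact ⟨0, fun φ => by simp⟩
    | add x y _ _ hx hy =>
      obtain ⟨a, ha⟩ := hx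
      obtain ⟨c, hc⟩ := hy
      exact ⟨a + c, fun φ => by simp [ha, hc]⟩
    | smul k x _ hx =>
      obtain ⟨a, ha⟩ := hx
      exact ⟨k • a, fun φ => by simp [ha]⟩
  · rintro ⟨a, ha⟩
    have : x = ∑ i, b.repr a i • B i := by
      ext φ
      rw [ha, sum_mul_basis b a φ, Finset.sum_apply]
      exact Finset.sum_congr rfl fun i _ => by rw [Pi.smul_apply, hB, zsmul_eq_mul]
    rw [this]
    exact sum_mem fun i _ => Submodule.smul_mem _ _ (Submodule.subset_span ⟨_, rfl⟩)
  · rw [ZSpan.volume_fundamentalDomain, ← hb]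
    congr 3
    ext i φ
    exact hB i φ

/-- A fundamental domain for the stabilizer of `∞`. -/
def stabDomain (ψ : Fin n ≃ (K →+* ℝ)) (ε : Fin (n - 1) → (𝓞 K)ˣ)
    (B : Module.Basis (K →+* ℝ) ℝ ((K →+* ℝ) → ℝ)) : Set (HalfSpace K) :=
  {z | (fun φ => (z φ).re) ∈ ZSpan.fundamentalDomain B ∧
    Matrix.vecMul (logIm ψ z) (unitMatrix ψ ε)⁻¹ ∈ strip n}

theorem measurable_vecMul (M : Matrix (Fin n) (Fin n) ℝ) :
    Measurable fun c : Fin n → ℝ => Matrix.vecMul c M :=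
  (Continuous.matrix_vecMul continuous_id continuous_const).measurable

theorem measurableSet_stabDomain (ψ : Fin n ≃ (K →+* ℝ)) (ε : Fin (n - 1) → (𝓞 K)ˣ)
    (B : Module.Basis (K →+* ℝ) ℝ ((K →+* ℝ) → ℝ)) : MeasurableSet (stabDomain ψ ε B) := by
  have h1 : Measurable fun (z : HalfSpace K) (φ : K →+* ℝ) => (z φ).re :=
    measurable_pi_lambda _ fun φ =>
      UpperHalfPlane.continuous_re.measurable.comp (measurable_pi_apply φ)
  have h2 : Measurable (logIm ψ : HalfSpace K → Fin n → ℝ) :=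
    measurable_pi_lambda _ fun j => Real.measurable_log.comp
      (UpperHalfPlane.continuous_im.measurable.comp (measurable_pi_apply (ψ j)))
  exact (h1 (ZSpan.fundamentalDomain_measurableSet B)).inter
    (((measurable_vecMul _).comp h2) measurableSet_strip)

theorem vecMul_logIm_upperMat_smul [NumberField.IsTotallyReal K] (hn : Module.finrank ℚ K = n)
    (ψ : Fin n ≃ (K →+* ℝ)) {ε : Fin (n - 1) → (𝓞 K)ˣ}
    (hε : Subgroup.closure (insert (-1) (Set.range ε)) = ⊤)
    (k : Fin (n - 1) → ℤ) {u : (𝓞 K)ˣ} (hu : u = ∏ q, ε q ^ k q ∨ u = -∏ q, ε q ^ k q)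
    (b : 𝓞 K) (z : HalfSpace K) :
    Matrix.vecMul (logIm ψ ((QuotientGroup.mk (upperMat u b) : ModularGroup K) • z))
      (unitMatrix ψ ε)⁻¹ =
      Matrix.vecMul (logIm ψ z) (unitMatrix ψ ε)⁻¹ + (2 : ℝ) • unitCoord k := by
  rw [logIm_upperMat_smul ψ ε k hu, Matrix.add_vecMul, Matrix.smul_vecMul, Matrix.vecMul_vecMul,
    Matrix.mul_nonsing_inv _ (isUnit_iff_ne_zero.2 (det_unitMatrix_ne_zero hn ψ hε)),
    Matrix.vecMul_one]

/-- As `[0, 2)` represents `ℝ` modulo `2ℤ`, exactly one integer vector moves `c` into the strip;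
this gives both existence and uniqueness of the unit, up to sign. -/
theorem add_two_smul_mem_strip (c : Fin n → ℝ) (k : Fin (n - 1) → ℤ) :
    c + (2 : ℝ) • unitCoord k ∈ strip n ↔
      ∀ q, k q = -⌊c (Fin.castLE (Nat.sub_le n 1) q) / 2⌋ := by
  have key : ∀ (x : ℝ) (a : ℤ), x + 2 * a ∈ Set.Ico (0 : ℝ) 2 ↔ a = -⌊x / 2⌋ := by
    intro x a
    rw [eq_neg_iff_add_eq_zero, add_comm a, ← Int.floor_add_intCast, Int.floor_eq_zero_iff,
      Set.mem_Ico, Set.mem_Ico]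
    constructor <;> rintro ⟨h1, h2⟩ <;> constructor <;> linarith
  constructor
  · intro h q
    have := h (Fin.castLE (Nat.sub_le n 1) q) q.2
    rw [← key]
    simpa [unitCoord] using this
  · intro h i hi
    have := (key _ _).2 (h ⟨i, hi⟩)
    simpa [unitCoord, hi] using this

/-- The strip condition determines the unit `u` up to sign, the lattice cell then determines the
translation `ub`, and the pairs `(u, b)` and `(-u, -b)` give the same class in `PSL`. -/
theorem isFundamentalDomain_stabDomain [NumberField.IsTotallyReal K]
    (hn : Module.finrank ℚ K = n) (ψ : Fin n ≃ (K →+* ℝ)) {ε : Fin (n - 1) → (𝓞 K)ˣ}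
    (hε : Subgroup.closure (insert (-1) (Set.range ε)) = ⊤)
    {B : Module.Basis (K →+* ℝ) ℝ ((K →+* ℝ) → ℝ)}
    (hB : ∀ x : (K →+* ℝ) → ℝ, x ∈ Submodule.span ℤ (Set.range B) ↔
      ∃ a : 𝓞 K, ∀ φ, x φ = φ (a : K)) :
    IsFundamentalDomain (stabInfty K) (stabDomain ψ ε B) volume := by
  have : Nonempty (K →+* ℝ) := ⟨ψ ⟨0, finrank_pos_of_eq hn⟩⟩
  refine .mk' (measurableSet_stabDomain ψ ε B).nullMeasurableSet fun z => ?_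
  set c := Matrix.vecMul (logIm ψ z) (unitMatrix ψ ε)⁻¹ with hc
  let k : Fin (n - 1) → ℤ := fun q => -⌊c (Fin.castLE (Nat.sub_le n 1) q) / 2⌋
  let u : (𝓞 K)ˣ := ∏ q, ε q ^ k q
  let x : (K →+* ℝ) → ℝ := fun φ => φ ((u : 𝓞 K) : K) ^ 2 * (z φ).re
  obtain ⟨v, hv, hvu⟩ := ZSpan.exist_unique_vadd_mem_fundamentalDomain B x
  obtain ⟨a, ha⟩ := (hB v).1 v.2
  have hre : ∀ (w : (𝓞 K)ˣ) (b : 𝓞 K), (∀ φ : K →+* ℝ, φ ((w : 𝓞 K) : K) ^ 2 =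
      φ ((u : 𝓞 K) : K) ^ 2) →
      (fun φ => (((QuotientGroup.mk (upperMat w b) : ModularGroup K) • z) φ).re) =
        (fun φ : K →+* ℝ => φ (((w : 𝓞 K) * b : 𝓞 K) : K)) + x := by
    intro w b hw
    ext φ
    rw [upperMat_smul_re, hw, Pi.add_apply, add_comm]
  -- The matrix with entries `u` and `b` translates by `ub`, so the upper right entry must be `u⁻¹
  -- a` to translate by `a`.
  have hua : (u : 𝓞 K) * (((u⁻¹ : (𝓞 K)ˣ) : 𝓞 K) * a) = a := by
    rw [← mul_assoc, Units.mul_inv, one_mul]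
  refine ⟨⟨QuotientGroup.mk (upperMat u (((u⁻¹ : (𝓞 K)ˣ) : 𝓞 K) * a)), upperMat_mem _ _⟩,
    ⟨?_, ?_⟩, ?_⟩
  · change (fun φ => (((QuotientGroup.mk (upperMat u (((u⁻¹ : (𝓞 K)ˣ) : 𝓞 K) * a)) :
      ModularGroup K) • z) φ).re) ∈ _
    rw [hre u _ fun _ => rfl, hua]
    convert hv using 1
    ext φ
    exact congrArg (· + x φ) (ha φ).symm
  · change Matrix.vecMul (logIm ψ ((QuotientGroup.mk (upperMat u (((u⁻¹ : (𝓞 K)ˣ) : 𝓞 K) * a)) :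
      ModularGroup K) • z)) _ ∈ _
    rw [vecMul_logIm_upperMat_smul hn ψ hε k (Or.inl rfl), add_two_smul_mem_strip]
    exact fun q => rfl
  · rintro ⟨σ, hσ⟩ ⟨h1, h2⟩
    obtain ⟨w, b, rfl⟩ := exists_eq_mk_upperMat hσ
    obtain ⟨k', hk'⟩ := exists_unit_eq_prod_zpow hε w
    have h2' : Matrix.vecMul (logIm ψ ((QuotientGroup.mk (upperMat w b) : ModularGroup K) • z))
      (unitMatrix ψ ε)⁻¹ ∈ strip n := h2
    rw [vecMul_logIm_upperMat_smul hn ψ hε k' hk', add_two_smul_mem_strip] at h2'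
    have hkk : k' = k := funext h2'
    subst hkk
    have h1' : (fun φ => (((QuotientGroup.mk (upperMat w b) : ModularGroup K) • z) φ).re) ∈
      ZSpan.fundamentalDomain B := h1
    -- Only squares of units act on the half planes, so the sign of `w` does not affect the real
    -- parts.
    have hsq : ∀ φ : K →+* ℝ, φ ((w : 𝓞 K) : K) ^ 2 = φ ((u : 𝓞 K) : K) ^ 2 := fun φ => by
      rcases hk' with h | h <;> simp [h, u]
    rw [hre w b hsq] at h1'
    have hmem : (fun φ : K →+* ℝ => φ (((w : 𝓞 K) * b : 𝓞 K) : K)) ∈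
        Submodule.span ℤ (Set.range B) := (hB _).2 ⟨_, fun φ => rfl⟩
    have heq := congrArg Subtype.val (hvu ⟨_, hmem⟩ h1')
    have hab : (w : 𝓞 K) * b = a := by
      obtain ⟨φ⟩ := ‹Nonempty (K →+* ℝ)›
      have h3 := (congrFun heq φ).trans (ha φ)
      exact_mod_cast φ.injective h3
    have hb : b = ((w⁻¹ : (𝓞 K)ˣ) : 𝓞 K) * a := by
      rw [← hab, ← mul_assoc, Units.inv_mul, one_mul]
    refine Subtype.ext ?_
    change (QuotientGroup.mk (upperMat w b) : ModularGroup K) =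
      QuotientGroup.mk (upperMat u (((u⁻¹ : (𝓞 K)ˣ) : 𝓞 K) * a))
    rcases hk' with h | h
    · rw [hb, h]
    · have hw : w = -u := h
      rw [← mk_neg (upperMat u _), ← upperMat_neg, hb, hw]
      congr 2
      simp

theorem integral_withDensity_exp {f : ((K →+* ℝ) → ℝ) → ℂ} :
    (Integrable f ((volume : Measure ((K →+* ℝ) → ℝ)).withDensity
        fun v => ENNReal.ofReal (Real.exp (-∑ φ, v φ))) ↔
      Integrable fun v : (K →+* ℝ) → ℝ => Real.exp (-∑ φ, v φ) • f v) ∧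
    ∫ v, f v ∂((volume : Measure ((K →+* ℝ) → ℝ)).withDensity
        fun v => ENNReal.ofReal (Real.exp (-∑ φ, v φ))) =
      ∫ v : (K →+* ℝ) → ℝ, Real.exp (-∑ φ, v φ) • f v := by
  have hm : Measurable fun v : (K →+* ℝ) → ℝ => ENNReal.ofReal (Real.exp (-∑ φ, v φ)) := by
    fun_prop
  have ht : ∀ᵐ v : (K →+* ℝ) → ℝ, ENNReal.ofReal (Real.exp (-∑ φ, v φ)) < ⊤ :=
    .of_forall fun _ => ENNReal.ofReal_lt_top
  constructor
  · rw [integrable_withDensity_iff_integrable_smul' hm ht]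
    simp only [ENNReal.toReal_ofReal (Real.exp_pos _).le]
  · rw [integral_withDensity_eq_integral_toReal_smul hm ht]
    simp only [ENNReal.toReal_ofReal (Real.exp_pos _).le]

/-- In the chart the domain is a product and the integrand does not depend on `x`. Fubini separates
the cell of volume `√D` from the strip integral. -/
theorem integral_stabDomain [NumberField.IsTotallyReal K]
    (hn : Module.finrank ℚ K = n) (ψ : Fin n ≃ (K →+* ℝ)) {ε : Fin (n - 1) → (𝓞 K)ˣ}
    (hε : Subgroup.closure (insert (-1) (Set.range ε)) = ⊤)
    {B : Module.Basis (K →+* ℝ) ℝ ((K →+* ℝ) → ℝ)}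
    (hB : volume (ZSpan.fundamentalDomain B) =
      ENNReal.ofReal (Real.sqrt |(NumberField.discr K : ℝ)|))
    {h : ℝ → ℂ} (hh : IsInducing h) (m : Fin (n - 1) → ℤ) :
    IntegrableOn (fun z => logTerm ψ ε h m (logIm ψ z)) (stabDomain ψ ε B) volume ∧
    ∫ z in stabDomain ψ ε B, logTerm ψ ε h m (logIm ψ z) =
      ((Real.sqrt |(NumberField.discr K : ℝ)| : ℝ) : ℂ) *
        (((n * NumberField.Units.regulator K : ℝ) : ℂ) * ∏ i, ∫ t, sliceFn h m i t) := by
  have hDm := ZSpan.fundamentalDomain_measurableSet B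
  have hSm := measurableSet_stabDomain ψ ε B
  let F : ((K →+* ℝ) → ℝ) → ℂ := (ZSpan.fundamentalDomain B).indicator fun _ => 1
  -- `ψ` passes from coordinates indexed by embeddings to `Fin n`; the density `e^{-∑ v}` is left to
  -- the measure here, whereas `stripFn` includes it.
  let G : ((K →+* ℝ) → ℝ) → ℂ := fun v =>
    {v | Matrix.vecMul v (unitMatrix ψ ε)⁻¹ ∈ strip n}.indicator
      (fun v => logTerm ψ ε h m v) fun j => v (ψ j)
  have hFG : ∀ p, (stabDomain ψ ε B).indicator (fun z => logTerm ψ ε h m (logIm ψ z))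
      (halfSpaceChart K p) = F p.1 * G p.2 := by
    intro p
    have hlog : logIm ψ (halfSpaceChart K p) = fun j => p.2 (ψ j) := by
      ext j
      rw [logIm, halfSpaceChart_im, Real.log_exp]
    have hiff : halfSpaceChart K p ∈ stabDomain ψ ε B ↔ p.1 ∈ ZSpan.fundamentalDomain B ∧
        (fun j => p.2 (ψ j)) ∈ {v | Matrix.vecMul v (unitMatrix ψ ε)⁻¹ ∈ strip n} := by
      rw [← hlog]
      rfl
    by_cases h1 : p.1 ∈ ZSpan.fundamentalDomain B
    · by_cases h2 : (fun j => p.2 (ψ j)) ∈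
          {v | Matrix.vecMul v (unitMatrix ψ ε)⁻¹ ∈ strip n}
      · rw [Set.indicator_of_mem (hiff.2 ⟨h1, h2⟩)]
        simp only [F, G]
        rw [Set.indicator_of_mem h1, Set.indicator_of_mem h2, one_mul, hlog]
      · rw [Set.indicator_of_notMem fun h => h2 (hiff.1 h).2]
        simp only [F, G]
        rw [Set.indicator_of_notMem h2, mul_zero]
    · rw [Set.indicator_of_notMem fun h => h1 (hiff.1 h).1]
      simp only [F, G]
      rw [Set.indicator_of_notMem h1, zero_mul]
  have hFi : Integrable F := by
    rw [integrable_indicator_iff hDm]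
    exact integrableOn_const (by rw [hB]; exact ENNReal.ofReal_ne_top)
  have hFv : ∫ x, F x = ((Real.sqrt |(NumberField.discr K : ℝ)| : ℝ) : ℂ) := by
    rw [integral_indicator hDm, setIntegral_const, Measure.real, hB,
      ENNReal.toReal_ofReal (Real.sqrt_nonneg _), Complex.real_smul, mul_one]
  have hGs : ∀ v : (K →+* ℝ) → ℝ, Real.exp (-∑ φ, v φ) • G v =
      stripFn ψ ε h m fun j => v (ψ j) := by
    intro v
    simp only [G, stripFn]
    rw [← ψ.sum_comp]
    by_cases h2 : (fun j => v (ψ j)) ∈ {v | Matrix.vecMul v (unitMatrix ψ ε)⁻¹ ∈ strip n}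
    · rw [Set.indicator_of_mem h2, Set.indicator_of_mem h2]
    · rw [Set.indicator_of_notMem h2, Set.indicator_of_notMem h2, smul_zero]
  have hψ : MeasurePreserving (MeasurableEquiv.piCongrLeft (fun _ : K →+* ℝ => ℝ) ψ).symm
      volume volume :=
    (volume_measurePreserving_piCongrLeft (fun _ : K →+* ℝ => ℝ) ψ).symm
  have hψa : ∀ v : (K →+* ℝ) → ℝ,
      (MeasurableEquiv.piCongrLeft (fun _ : K →+* ℝ => ℝ) ψ).symm v = fun j => v (ψ j) :=
    fun v => rfl
  have hGi : Integrable G ((volume : Measure ((K →+* ℝ) → ℝ)).withDensity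
        fun v => ENNReal.ofReal (Real.exp (-∑ φ, v φ))) := by
    rw [integral_withDensity_exp.1]
    simp_rw [hGs, ← hψa]
    exact (hψ.integrable_comp_emb (MeasurableEquiv.measurableEmbedding _)).2
      (integrable_stripFn hn ψ hε hh m)
  have hGv : ∫ v, G v ∂((volume : Measure ((K →+* ℝ) → ℝ)).withDensity
        fun v => ENNReal.ofReal (Real.exp (-∑ φ, v φ))) =
      ((n * NumberField.Units.regulator K : ℝ) : ℂ) * ∏ i, ∫ t, sliceFn h m i t := by
    rw [integral_withDensity_exp.2, ← integral_stripFn hn ψ hε]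
    simp_rw [hGs, ← hψa]
    exact hψ.integral_comp (MeasurableEquiv.measurableEmbedding _) _
  have hΘ := measurePreserving_halfSpaceChart (K := K)
  constructor
  · rw [← integrable_indicator_iff hSm,
      ← hΘ.integrable_comp_emb (MeasurableEquiv.measurableEmbedding _)]
    simp only [Function.comp_def, hFG]
    exact hFi.mul_prod hGi
  · rw [← integral_indicator hSm,
      ← hΘ.integral_comp (MeasurableEquiv.measurableEmbedding _)]
    simp only [hFG]
    rw [integral_prod_mul, hFv, hGv]

/-! ### Unfolding -/

section Unfolding

open scoped Pointwise

variable {G X : Type*} [Group G] [Countable G] [MulAction G X] [MeasurableSpace X]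
  [MeasurableConstSMul G X] {μ : Measure X} [SMulInvariantMeasure G X μ]

/-- The union of the translates of a fundamental domain by representatives of the right cosets of a
subgroup is a fundamental domain for the subgroup. -/
theorem isFundamentalDomain_iUnion_out (H : Subgroup G) {s : Set X}
    (hs : IsFundamentalDomain G s μ) :
    IsFundamentalDomain H (⋃ c : Quotient (QuotientGroup.rightRel H), c.out • s) μ where
  nullMeasurableSet := NullMeasurableSet.iUnion fun c => hs.nullMeasurableSet_smul _
  ae_covers := by
    filter_upwards [hs.ae_covers] with x hx
    obtain ⟨g, hg⟩ := hx
    -- Since `g • x ∈ s`, the representative of the coset of `g⁻¹` yields an element `c.out * g` of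
    -- `H` that carries `x` into `c.out • s`.
    let c : Quotient (QuotientGroup.rightRel H) := Quotient.mk'' g⁻¹
    have hr : (QuotientGroup.rightRel H) c.out g⁻¹ := Quotient.mk_out g⁻¹
    rw [QuotientGroup.rightRel_apply] at hr
    have hH : c.out * g ∈ H := by simpa using H.inv_mem hr
    refine ⟨⟨c.out * g, hH⟩, Set.mem_iUnion.2 ⟨c, ?_⟩⟩
    rw [Subgroup.mk_smul, mul_smul]
    exact Set.smul_mem_smul_set hg
  aedisjoint := by
    intro a b hab
    change AEDisjoint μ ((a : G) • ⋃ c : Quotient (QuotientGroup.rightRel H), c.out • s)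
      ((b : G) • ⋃ c : Quotient (QuotientGroup.rightRel H), c.out • s)
    simp only [Set.smul_set_iUnion, AEDisjoint.iUnion_left_iff, AEDisjoint.iUnion_right_iff,
      smul_smul]
    intro d c
    -- Translates of `s` by distinct elements are almost disjoint, so it is enough that `a * c.out =
    -- b * d.out` forces `c = d` and then `a = b`.
    refine hs.aedisjoint fun h => hab ?_
    have hcd : c = d := by
      rw [← Quotient.out_eq' c, ← Quotient.out_eq' d, Quotient.eq'', QuotientGroup.rightRel_apply]
      have : d.out * c.out⁻¹ = (b : G)⁻¹ * a := by
        rw [mul_inv_eq_iff_eq_mul, mul_assoc, eq_inv_mul_iff_mul_eq, h]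
      rw [this]
      exact H.mul_mem (H.inv_mem b.2) a.2
    subst hcd
    exact Subtype.ext (mul_right_cancel h)

/-- Unfolding: the integral over a fundamental domain of the sum over the right cosets of a subgroup
is the integral over a fundamental domain of the subgroup. -/
theorem integral_tsum_out (H : Subgroup G) {s t : Set X} (hs : IsFundamentalDomain G s μ)
    (ht : IsFundamentalDomain H t μ) {f : X → ℂ} (hf : ∀ (g : H) (x : X), f (g • x) = f x)
    (hft : IntegrableOn f t μ)
    (hsum : ∀ x, Summable fun c : Quotient (QuotientGroup.rightRel H) => f (c.out • x)) :
    IntegrableOn (fun x => ∑' c : Quotient (QuotientGroup.rightRel H), f (c.out • x)) s μ ∧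
    ∫ x in s, ∑' c : Quotient (QuotientGroup.rightRel H), f (c.out • x) ∂μ =
      ∫ x in t, f x ∂μ := by
  have hcount : Countable (Quotient (QuotientGroup.rightRel H)) :=
    Quotient.mk''_surjective.countable
  have hU := isFundamentalDomain_iUnion_out H hs
  have hfU : IntegrableOn f (⋃ c : Quotient (QuotientGroup.rightRel H), c.out • s) μ :=
    (hU.integrableOn_iff ht hf).2 hft
  have hmeas : ∀ c : Quotient (QuotientGroup.rightRel H), NullMeasurableSet (c.out • s) μ :=
    fun c => hs.nullMeasurableSet_smul _
  have hdisj : Pairwise (Function.onFun (AEDisjoint μ)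
      fun c : Quotient (QuotientGroup.rightRel H) => c.out • s) := by
    intro c d hcd
    refine hs.aedisjoint fun h => hcd ?_
    rw [← Quotient.out_eq' c, ← Quotient.out_eq' d, h]
  have hint : ∀ g : G, ∫ x in g • s, f x ∂μ = ∫ x in s, f (g • x) ∂μ := fun g =>
    (measurePreserving_smul g μ).setIntegral_image_emb (measurableEmbedding_const_smul g) _ _
  have hlint : ∀ g : G, ∫⁻ x in g • s, ‖f x‖ₑ ∂μ = ∫⁻ x in s, ‖f (g • x)‖ₑ ∂μ := fun g =>
    ((measurePreserving_smul g μ).setLIntegral_comp_emb (measurableEmbedding_const_smul g)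
      (fun x => ‖f x‖ₑ) s).symm
  have haes : ∀ c : Quotient (QuotientGroup.rightRel H),
      AEStronglyMeasurable (fun x => f (c.out • x)) (μ.restrict s) := fun c => by
    have h1 : AEStronglyMeasurable f (μ.restrict (c.out • s)) :=
      (hfU.mono_set (Set.subset_iUnion (fun c : Quotient (QuotientGroup.rightRel H) =>
        c.out • s) c)).aestronglyMeasurable
    exact h1.comp_measurePreserving ((measurePreserving_smul c.out μ).restrict_image_emb
      (measurableEmbedding_const_smul c.out) s)
  -- The sum of the integrals of the norms is the integral of `‖f‖` over the union of translates, a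
  -- fundamental domain for `H`. Its finiteness gives integrability and permits exchanging sum and
  -- integral.
  have hfin : ∑' c : Quotient (QuotientGroup.rightRel H),
      ∫⁻ x in s, ‖f (c.out • x)‖ₑ ∂μ ≠ ⊤ := by
    simp_rw [← hlint]
    rw [← lintegral_iUnion₀ hmeas hdisj]
    exact hfU.hasFiniteIntegral.ne
  refine ⟨⟨?_, ?_⟩, ?_⟩
  -- Measurability of the sum comes from pointwise convergence of the partial sums, for which `hsum`
  -- is needed.
  · exact aestronglyMeasurable_of_tendsto_ae
      (atTop : Filter (Finset (Quotient (QuotientGroup.rightRel H))))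
      (f := fun S x => ∑ c ∈ S, f (c.out • x))
      (fun S => Finset.aestronglyMeasurable_fun_sum S fun c _ => haes c)
      (.of_forall fun x => (hsum x).hasSum)
  · refine lt_of_le_of_lt (lintegral_mono fun x => enorm_tsum_le_tsum_enorm) ?_
    rw [lintegral_tsum fun c => (haes c).enorm]
    exact lt_top_iff_ne_top.2 hfin
  · rw [integral_tsum haes hfin, hU.setIntegral_eq ht hf |>.symm]
    simp_rw [← hint]
    exact (hasSum_integral_iUnion_ae hmeas hdisj hfU).tsum_eq

end Unfolding

end HilbertModular

end

/-! ### Conclusion -/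

theorem mainTheorem10 (K : Type*) [Field K] [NumberField K] [NumberField.IsTotallyReal K]
    (hK : HilbertModular.NarrowClassNumberOne K)
    (n : ℕ) (hn : Module.finrank ℚ K = n) (ψ : Fin n ≃ (K →+* ℝ))
    (ε : Fin (n - 1) → (𝓞 K)ˣ)
    (hε : Subgroup.closure (insert (-1) (Set.range ε)) = ⊤)
    (h : ℝ → ℂ) (hh : HilbertModular.IsInducing h) (m : Fin (n - 1) → ℤ) :
    -- the terms depend only on the coset, and the series converges absolutely everywhere
    (∀ σ ∈ HilbertModular.stabInfty K, ∀ (γ : HilbertModular.ModularGroup K)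
      (z : HilbertModular.HalfSpace K),
      HilbertModular.eisensteinTerm ψ ε h m z (σ * γ) =
        HilbertModular.eisensteinTerm ψ ε h m z γ) ∧
    (∀ z : HilbertModular.HalfSpace K, Summable fun c : HilbertModular.Cosets K =>
      ‖HilbertModular.eisensteinTerm ψ ε h m z c.out‖) ∧
    -- the sum is invariant under the group
    (∀ (γ : HilbertModular.ModularGroup K) (z : HilbertModular.HalfSpace K),
      HilbertModular.incompleteEisenstein ψ ε h m (γ • z) =
        HilbertModular.incompleteEisenstein ψ ε h m z) ∧
    -- the integral over the quotient is the integral over any fundamental domain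
    (∃ 𝓕 : Set (HilbertModular.HalfSpace K),
      IsFundamentalDomain (HilbertModular.ModularGroup K) 𝓕 volume) ∧
    ∀ 𝓕 : Set (HilbertModular.HalfSpace K),
      IsFundamentalDomain (HilbertModular.ModularGroup K) 𝓕 volume →
      IntegrableOn (HilbertModular.incompleteEisenstein ψ ε h m) 𝓕 volume ∧
      (m ≠ 0 → ∫ z in 𝓕, HilbertModular.incompleteEisenstein ψ ε h m z = 0) ∧
      (m = 0 → IntegrableOn (fun w : ℝ => h w / (w : ℂ) ^ 2) (Set.Ioi 0) volume ∧
        ∫ z in 𝓕, HilbertModular.incompleteEisenstein ψ ε h m z =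
          ((2 ^ (n - 1) * NumberField.Units.regulator K *
            Real.sqrt |(NumberField.discr K : ℝ)| : ℝ) : ℂ) *
            ∫ w in Set.Ioi (0 : ℝ), h w / (w : ℂ) ^ 2) := by
  open HilbertModular in
  have hpos := finrank_pos_of_eq hn
  have : Nonempty (K →+* ℝ) := ⟨ψ ⟨0, hpos⟩⟩
  have hsum := summable_norm_eisensteinTerm hn ψ hε hh m
  refine ⟨fun σ hσ γ z => eisensteinTerm_mul_left hn ψ hε h m hσ γ z, hsum,
    incompleteEisenstein_smul hn ψ hε h m, exists_isFundamentalDomain_modularGroup,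
    fun 𝓕 h𝓕 => ?_⟩
  obtain ⟨B, hB, hvol⟩ := exists_basis_integers hn ψ
  obtain ⟨hint, hval⟩ := integral_stabDomain hn ψ hε hvol hh m
  have hE : incompleteEisenstein ψ ε h m =
      fun z => ∑' c : Cosets K, logTerm ψ ε h m (logIm ψ (c.out • z)) := by
    ext z
    exact tsum_congr fun c => eisensteinTerm_eq ψ ε h m z c.out
  obtain ⟨hi, hv⟩ := integral_tsum_out (stabInfty K) h𝓕
    (isFundamentalDomain_stabDomain hn ψ hε hB)
    (f := fun z => logTerm ψ ε h m (logIm ψ z))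
    (fun σ z => logTerm_logIm_smul hn ψ hε h m σ.2 z) hint
    (fun z => by
      simpa only [eisensteinTerm_eq] using (hsum z).of_norm)
  rw [hE]
  refine ⟨hi, fun hm => ?_, fun hm => ⟨hh.integrableOn_div_sq, ?_⟩⟩
  · rw [hv, hval, prod_integral_sliceFn_of_ne h hm, mul_zero, mul_zero]
  · subst hm
    rw [hv, hval, prod_integral_sliceFn_zero hpos]
    -- The `n` of the determinant `nR` cancels the `n⁻¹` of the last coordinate.
    have hn0 : (n : ℂ) ≠ 0 := by exact_mod_cast hpos.ne'
    push_cast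
    field_simp
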